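/- Let $\bar\alpha:=\frac{1+\sqrt{97}}{12}$, let $\alpha\in(\bar\alpha,1]$ and set $$\zeta(\alpha):=\min\Big(\frac13+\frac{2\alpha-1}{3(1-\alpha)},\ \frac{2\alpha(\alpha+1)}{4-4\alpha^2+3\alpha}\Big),$$ where for $\alpha=1$ the first entry is $+\infty$, so that $\zeta(1)=\frac43$. Notation. Let $\mathbb T=\mathbb R/2\pi\mathbb Z$, write $u(n)$ for the Fourier coefficients of $u\in L^2(\mathbb T)$ and normalise $\|u\|_{L^2}^2=\sum_n|u(n)|^2$. Let $\gamma_\alpha$ be the law on $L^2(\mathbb T)$ of $$\sum_{n\in\mathbb Z}\frac{g_n}{(1+|n|^{2\alpha})^{1/2}}\,e^{inx},$$ with $(g_n)_{n\in\mathbb Z}$ independent, centred, circularly symmetric complex Gaussian variables with $E|g_n|^2=1$. For $R>0$ let $\tilde\gamma_\alpha(A):=\gamma_\alpha(A\cap\{\|u\|_{L^2}\le R\})$. Let $\sigma\in\{1,-1\}$ and $$H(u):=\int_{\mathbb T}\big||D_x|^\alpha u\big|^2dx+\frac\sigma2\int_{\mathbb T}|u|^4dx .$$ For $N\in\mathbb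 N$ let $E_N:=\mathrm{span}_{\mathbb C}\{e^{inx}:|n|\le N\}$, let $\Pi_N$ be the orthogonal projection of $L^2(\mathbb T)$ onto $E_N$, and let $\Phi^N_t:E_N\to E_N$, $t\in\mathbb R$, be the truncated Birkhoff flow, that is, the flow of the system of ordinary differential equations $$\frac{d}{dt}u(n)=\sum_{\substack{|j_1|,|j_2|,|j_3|\le N,\ j_1+j_2-j_3=n\\ |j_1|^{2\alpha}+|j_2|^{2\alpha}\ne|j_3|^{2\alpha}+|n|^{2\alpha}}}\frac{-\sigma}{|j_1|^{2\alpha}+|j_2|^{2\alpha}-|j_3|^{2\alpha}-|n|^{2\alpha}}\,u(j_1)\,u(j_2)\,\overline{u(j_3)},\qquad |n|\le N .$$ For $u\in L^2(\mathbb T)$ put $G_N(u):=\frac{d}{dt}H[\Phi^N_t(\Pi_Nu)]\big|_{t=0}$. Proposition. One has $\zeta(\alpha)>1$, and for every $R>0$ there are constants $C,c>0$, depending only on $\alpha$ and $R$, such that for both $\sigma\in\{1,-1\}$ and all $N\in\mathbb N$ the derivative $G_N(u)$ exists for every $u$, and $$\|G_N\|_{L^p(\tilde\gamma_\alpha)}\le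 C\,p^{1/\zeta(\alpha)}\quad\text{for all real }p\ge1,$$ $$\tilde\gamma_\alpha\big(|G_N|\ge t\big)\le C\,e^{-c\,t^{\zeta(\alpha)}}\quad\text{for all }t\ge0 .$$ -/

import Mathlib

noncomputable section

namespace BirkhoffNLS

open MeasureTheory ProbabilityTheory
open scoped ENNReal NNReal

/-! ### The exponent -/

/-- The exponent `ζ(α) = min (1/3 + (2α-1)/(3(1-α))) (2α(α+1)/(4-4α²+3α))`. At `α = 1` the first
entry is `+∞`, so that the minimum is the second entry. -/
def zeta (α : ℝ) : ℝ :=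
  if α = 1 then 2 * α * (α + 1) / (4 - 4 * α ^ 2 + 3 * α)
  else min (1 / 3 + (2 * α - 1) / (3 * (1 - α))) (2 * α * (α + 1) / (4 - 4 * α ^ 2 + 3 * α))

/-! ### The Gaussian measure on `L²(𝕋)` -/

instance factTwoPiPos : Fact (0 < 2 * Real.pi) := ⟨Real.two_pi_pos⟩

/-- The torus `𝕋 = ℝ / 2πℤ`. -/
abbrev Torus : Type := AddCircle (2 * Real.pi)

/-- `L²(𝕋)`, complex valued, for the normalised Haar measure `dx / 2π`; thus the functions
`e^{inx}` are orthonormal and `‖u‖² = ∑ |u(n)|²`. -/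
abbrev L2T : Type := Lp ℂ 2 (AddCircle.haarAddCircle (T := 2 * Real.pi))

instance measurableSpaceL2T : MeasurableSpace L2T := borel L2T

instance borelSpaceL2T : BorelSpace L2T := ⟨rfl⟩

/-- `|n|^{2α}`. -/
def disp (α : ℝ) (n : ℤ) : ℝ := |(n : ℝ)| ^ (2 * α)

/-- The law of a centred complex Gaussian variable `g` with `E|g|² = 1`: the real and imaginary
parts are independent, centred, of variance `1/2`. -/
def stdComplexGaussian : Measure ℂ :=
  ((gaussianReal 0 (1 / 2)).prod (gaussianReal 0 (1 / 2))).map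
    (fun z : ℝ × ℝ => (z.1 : ℂ) + (z.2 : ℂ) * Complex.I)

instance isProbabilityMeasure_stdComplexGaussian : IsProbabilityMeasure stdComplexGaussian :=
  Measure.isProbabilityMeasure_map (by fun_prop)

/-- The law of a sequence `(g_n)` of independent variables, indexed by `n ∈ ℤ`, with the law
above. -/
def gaussianSequence : Measure (ℤ → ℂ) :=
  Measure.infinitePi (fun _ : ℤ => stdComplexGaussian)

instance isProbabilityMeasure_gaussianSequence : IsProbabilityMeasure gaussianSequence := by
  unfold gaussianSequence; infer_instance

/-- The random Fourier series `∑ g_n / (1 + |n|^{2α})^{1/2} e^{inx}`, summed in `L²(𝕋)`. -/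
def randomSeries (α : ℝ) (g : ℤ → ℂ) : L2T :=
  ∑' n : ℤ, (g n / (Real.sqrt (1 + disp α n) : ℂ)) • fourierLp (T := 2 * Real.pi) 2 n

/-- The Gaussian measure `γ_α` on `L²(𝕋)`: the law of the random Fourier series. -/
def gammaMeasure (α : ℝ) : Measure L2T := gaussianSequence.map (randomSeries α)

/-! For `α > 1/2` the series converges almost surely and its sum is a.e. measurable, so that `γ_α`
is a probability measure. -/

theorem lintegral_stdComplexGaussian_lt_top :
    ∫⁻ z, ENNReal.ofReal (‖z‖ ^ 2) ∂stdComplexGaussian < ∞ := by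
  have hm : MemLp (fun z : ℝ × ℝ => (z.1 : ℂ) + (z.2 : ℂ) * Complex.I) 2
      ((gaussianReal 0 (1 / 2)).prod (gaussianReal 0 (1 / 2))) := by
    have h1 : MemLp (fun z : ℝ × ℝ => z.1) 2
        ((gaussianReal 0 (1 / 2)).prod (gaussianReal 0 (1 / 2))) :=
      (memLp_id_gaussianReal' (μ := 0) (v := 1 / 2) 2 (by simp)).comp_fst _
    have h2 : MemLp (fun z : ℝ × ℝ => z.2) 2
        ((gaussianReal 0 (1 / 2)).prod (gaussianReal 0 (1 / 2))) :=
      (memLp_id_gaussianReal' (μ := 0) (v := 1 / 2) 2 (by simp)).comp_snd _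
    exact MemLp.add (f := fun z : ℝ × ℝ => (z.1 : ℂ))
      (g := fun z : ℝ × ℝ => (z.2 : ℂ) * Complex.I) h1.ofReal (h2.ofReal.mul_const Complex.I)
  rw [stdComplexGaussian, lintegral_map (f := fun z : ℂ => ENNReal.ofReal (‖z‖ ^ 2))
    (by fun_prop) (by fun_prop)]
  exact (hm.integrable_norm_pow (p := 2) (by simp)).lintegral_lt_top

/-- For `α > 1/2` the random Fourier series converges in `L²(𝕋)` almost surely. -/
theorem ae_hasSum_randomSeries {α : ℝ} (hα : 1 / 2 < α) : ∀ᵐ g ∂gaussianSequence,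
    HasSum (fun n : ℤ => (g n / (Real.sqrt (1 + disp α n) : ℂ)) •
      fourierLp (T := 2 * Real.pi) 2 n) (randomSeries α g) := by
  have hd : ∀ n, 0 ≤ disp α n := fun n => Real.rpow_nonneg (abs_nonneg _) _
  have hsum : Summable fun n : ℤ => (1 + disp α n)⁻¹ := by
    have h := (Real.summable_abs_int_rpow (b := 2 * α) (by linarith))
    refine Summable.of_norm_bounded_eventually h ?_
    filter_upwards [(Set.finite_singleton (0 : ℤ)).compl_mem_cofinite] with n hn
    have hn0 : (0 : ℝ) < |(n : ℝ)| := abs_pos.2 (by exact_mod_cast hn)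
    have hp : 0 < disp α n := Real.rpow_pos_of_pos hn0 _
    rw [Real.norm_of_nonneg (by positivity), Real.rpow_neg (abs_nonneg _)]
    exact inv_anti₀ hp (by simp [disp])
  have hmeas : ∀ n : ℤ, Measurable fun g : ℤ → ℂ =>
      ENNReal.ofReal (‖g n‖ ^ 2) * ENNReal.ofReal ((1 + disp α n)⁻¹) := fun n =>
    ((measurable_pi_apply n).norm.pow_const 2).ennreal_ofReal.mul_const _
  have hlt : ∫⁻ g, ∑' n : ℤ, ENNReal.ofReal (‖g n‖ ^ 2) * ENNReal.ofReal ((1 + disp α n)⁻¹)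
      ∂gaussianSequence ≠ ∞ := by
    rw [lintegral_tsum (fun n => (hmeas n).aemeasurable)]
    have : ∀ n : ℤ, ∫⁻ g : ℤ → ℂ, ENNReal.ofReal (‖g n‖ ^ 2) * ENNReal.ofReal ((1 + disp α n)⁻¹)
        ∂gaussianSequence = (∫⁻ z, ENNReal.ofReal (‖z‖ ^ 2) ∂stdComplexGaussian) *
          ENNReal.ofReal ((1 + disp α n)⁻¹) := by
      intro n
      rw [lintegral_mul_const _ (by fun_prop)]
      congr 1
      have hmp := measurePreserving_eval_infinitePi (fun _ : ℤ => stdComplexGaussian) n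
      exact hmp.lintegral_comp (f := fun z : ℂ => ENNReal.ofReal (‖z‖ ^ 2)) (by fun_prop)
    simp_rw [this]
    rw [ENNReal.tsum_mul_left, ← ENNReal.ofReal_tsum_of_nonneg
      (fun n => by have := hd n; positivity) hsum]
    exact ENNReal.mul_ne_top lintegral_stdComplexGaussian_lt_top.ne ENNReal.ofReal_ne_top
  have hae := ae_lt_top (Measurable.tsum fun n => hmeas n) hlt
  filter_upwards [hae] with g hg
  refine Summable.hasSum ?_
  have hof := (orthonormal_fourier (T := 2 * Real.pi)).orthogonalFamily
  have := (hof.summable_iff_norm_sq_summable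
    (fun n => g n / (Real.sqrt (1 + disp α n) : ℂ))).2 ?_
  · exact this.congr fun n => (LinearIsometry.toSpanSingleton_apply _ _)
  · have h2 := ENNReal.summable_toReal hg.ne
    refine h2.congr fun n => ?_
    have h1 : 0 ≤ 1 + disp α n := by have := hd n; linarith
    rw [ENNReal.toReal_mul, ENNReal.toReal_ofReal (by positivity),
      ENNReal.toReal_ofReal (by positivity), norm_div, div_pow, Complex.norm_real,
      Real.norm_of_nonneg (Real.sqrt_nonneg _), Real.sq_sqrt h1, div_eq_mul_inv]

/-- For `α > 1/2` the push-forward defining `γ_α` is that of an a.e. measurable map. -/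
theorem aemeasurable_randomSeries {α : ℝ} (hα : 1 / 2 < α) :
    AEMeasurable (randomSeries α) gaussianSequence := by
  have hlim : ∀ᵐ g ∂gaussianSequence, Filter.Tendsto (fun s : Finset ℤ =>
      ∑ n ∈ s, (g n / (Real.sqrt (1 + disp α n) : ℂ)) • fourierLp (T := 2 * Real.pi) 2 n)
      Filter.atTop (nhds (randomSeries α g)) := by
    filter_upwards [ae_hasSum_randomSeries hα] with g hg
    rwa [HasSum, SummationFilter.unconditional_filter] at hg
  refine aemeasurable_of_tendsto_metrizable_ae Filter.atTop (fun s => ?_) hlim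
  have hcont : Continuous fun g : ℤ → ℂ =>
      ∑ n ∈ s, (g n / (Real.sqrt (1 + disp α n) : ℂ)) • fourierLp (T := 2 * Real.pi) 2 n := by
    refine continuous_finsetSum _ fun n _ => ?_
    have h1 : Continuous fun g : ℤ → ℂ => g n / (Real.sqrt (1 + disp α n) : ℂ) :=
      (continuous_apply n).div_const _
    exact h1.smul continuous_const
  exact hcont.measurable.aemeasurable

theorem isProbabilityMeasure_gammaMeasure {α : ℝ} (hα : 1 / 2 < α) :
    IsProbabilityMeasure (gammaMeasure α) :=
  Measure.isProbabilityMeasure_map (aemeasurable_randomSeries hα)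

/-- The restriction `γ̃_α` of `γ_α` to the ball `{‖u‖_{L²} ≤ R}` (not renormalised). -/
def gammaTilde (α R : ℝ) : Measure L2T := (gammaMeasure α).restrict {u | ‖u‖ ≤ R}

/-! ### Trigonometric polynomials, energy, Birkhoff flow -/

/-- The frequencies `n ∈ ℤ` with `|n| ≤ N`. -/
abbrev Modes (N : ℕ) : Type := Finset.Icc (-(N : ℤ)) (N : ℤ)

/-- The space `E_N` of trigonometric polynomials of degree at most `N`, in Fourier coordinates:
`u` stands for the function `x ↦ ∑_{|n| ≤ N} u(n) e^{inx}`. -/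
abbrev EN (N : ℕ) : Type := Modes N → ℂ

/-- The trigonometric polynomial with the given Fourier coefficients, as a function. -/
def EN.toFun {N : ℕ} (u : EN N) (x : ℝ) : ℂ :=
  ∑ n, u n * Complex.exp (Complex.I * ((n : ℤ) : ℂ) * (x : ℂ))

/-- The Fourier multiplier `|D_x|^α` on `E_N`. -/
def fracDeriv (α : ℝ) {N : ℕ} (u : EN N) : EN N :=
  fun n => ((|((n : ℤ) : ℝ)| ^ α : ℝ) : ℂ) * u n

/-- The energy `H^{(α)}(u) = ∫_𝕋 ||D_x|^α u|² dx + (σ/2) ∫_𝕋 |u|⁴ dx` on `E_N`. -/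
def energy (σ α : ℝ) {N : ℕ} (u : EN N) : ℝ :=
  (∫ x in (0 : ℝ)..(2 * Real.pi), ‖(fracDeriv α u).toFun x‖ ^ 2) +
    σ / 2 * ∫ x in (0 : ℝ)..(2 * Real.pi), ‖u.toFun x‖ ^ 4

/-- The projection `Π_N : L²(𝕋) → E_N`. -/
def proj (N : ℕ) (u : L2T) : EN N := fun n => fourierCoeff (T := 2 * Real.pi) u n

/-- The coefficient `-σ / (|a|^{2α} + |b|^{2α} - |c|^{2α} - |d|^{2α})` if `a + b = c + d` and the
denominator does not vanish, and `0` otherwise. -/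
def kernel (σ α : ℝ) (a b c d : ℤ) : ℝ :=
  if a + b = c + d ∧ disp α a + disp α b ≠ disp α c + disp α d then
    -σ / (disp α a + disp α b - disp α c - disp α d)
  else 0

/-- The vector field of the truncated Birkhoff flow: its `n`-th Fourier coefficient is
`∑ -σ / (|j₁|^{2α} + |j₂|^{2α} - |j₃|^{2α} - |n|^{2α}) u(j₁) u(j₂) conj(u(j₃))` over
`|j₁|, |j₂|, |j₃| ≤ N` with `j₁ + j₂ - j₃ = n` and nonvanishing denominator. -/
def birkhoffField (σ α : ℝ) {N : ℕ} (u : EN N) : EN N :=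
  fun n => ∑ j₁ : Modes N, ∑ j₂ : Modes N, ∑ j₃ : Modes N,
    (kernel σ α j₁ j₂ j₃ n : ℂ) * u j₁ * u j₂ * starRingEnd ℂ (u j₃)

/-- `Φ` is a global flow of the Birkhoff vector field on `E_N`. -/
def IsBirkhoffFlow (σ α : ℝ) (N : ℕ) (Φ : ℝ → EN N → EN N) : Prop :=
  ∀ u, Φ 0 u = u ∧ ∀ t, HasDerivAt (fun s => Φ s u) (birkhoffField σ α (Φ t u)) t

/-! Existence and uniqueness of the flow, needed for its definition. -/

theorem exists_global_of_lipschitz {E : Type*} [NormedAddCommGroup E] [NormedSpace ℝ E]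
    [CompleteSpace E] {f : E → E} {K L : ℝ≥0} (hK : LipschitzWith K f) (hL : ∀ x, ‖f x‖ ≤ L)
    (x : E) : ∃ γ : ℝ → E, γ 0 = x ∧ ∀ t, HasDerivAt γ (f (γ t)) t := by
  have key : ∀ a : ℝ, 0 < a → ∃ γ : ℝ → E, γ 0 = x ∧
      ∀ t ∈ Set.Ioo (-a) a, HasDerivAt γ (f (γ t)) t := by
    intro a ha
    have hpl : IsPicardLindelof (fun _ : ℝ => f)
        (⟨0, by constructor <;> linarith⟩ : Set.Icc (-a) a) x (L * a.toNNReal) 0 L K := by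
      refine IsPicardLindelof.of_time_independent (fun y _ => hL y) (hK.lipschitzOnWith) ?_
      simp [ha.le]
    obtain ⟨γ, h0, hγ⟩ := hpl.exists_eq_forall_mem_Icc_hasDerivWithinAt₀
    exact ⟨γ, h0, fun t ht => (hγ t (Set.Ioo_subset_Icc_self ht)).hasDerivAt
      (Icc_mem_nhds ht.1 ht.2)⟩
  choose! γ hγ0 hγ using key
  have huniq : ∀ a b : ℝ, 0 < a → a ≤ b → Set.EqOn (γ a) (γ b) (Set.Ioo (-a) a) := by
    intro a b ha hab
    refine ODE_solution_unique_of_mem_Ioo (v := fun _ => f) (s := fun _ => Set.univ) (K := K)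
      (t₀ := 0) (fun t _ => hK.lipschitzOnWith) ⟨by linarith, ha⟩
      (fun t ht => ⟨hγ a ha t ht, trivial⟩)
      (fun t ht => ⟨hγ b (by linarith) t ⟨by linarith [ht.1], by linarith [ht.2]⟩, trivial⟩) ?_
    rw [hγ0 a ha, hγ0 b (by linarith)]
  have hpos : ∀ t : ℝ, 0 < |t| + 1 := fun t => by positivity
  refine ⟨fun t => γ (|t| + 1) t, hγ0 _ (hpos 0), fun t => ?_⟩
  have hmem : ∀ s : ℝ, s ∈ Set.Ioo (-(|s| + 1)) (|s| + 1) := fun s =>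
    ⟨by linarith [neg_abs_le s], by linarith [le_abs_self s]⟩
  have hd := hγ (|t| + 1) (hpos t) t (hmem t)
  refine hd.congr_of_eventuallyEq ?_
  filter_upwards [Ioo_mem_nhds (hmem t).1 (hmem t).2] with s hs
  rcases le_total |s| |t| with h | h
  · exact huniq _ _ (hpos s) (by linarith) (hmem s)
  · exact (huniq _ _ (hpos t) (by linarith) hs).symm

theorem kernel_swap (σ α : ℝ) (a b c d : ℤ) : kernel σ α c d a b = -kernel σ α a b c d := by
  unfold kernel
  by_cases h : a + b = c + d ∧ disp α a + disp α b ≠ disp α c + disp α d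
  · rw [if_pos h, if_pos ⟨h.1.symm, h.2.symm⟩, ← div_neg]
    congr 1; ring
  · rw [if_neg h, if_neg (fun h' => h ⟨h'.1.symm, h'.2.symm⟩), neg_zero]

theorem re_sum_field (σ α : ℝ) {N : ℕ} (u : EN N) :
    (∑ n, starRingEnd ℂ (u n) * birkhoffField σ α u n).re = 0 := by
  set S : ℂ := ∑ n, starRingEnd ℂ (u n) * birkhoffField σ α u n with hS
  have h1 : S = ∑ p : Modes N × Modes N, ∑ q : Modes N × Modes N,
      (kernel σ α p.1 p.2 q.1 q.2 : ℂ) *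
        (u p.1 * u p.2 * starRingEnd ℂ (u q.1) * starRingEnd ℂ (u q.2)) := by
    rw [hS]
    simp only [birkhoffField, Finset.mul_sum, Fintype.sum_prod_type]
    rw [Finset.sum_comm]
    refine Finset.sum_congr rfl fun j₁ _ => ?_
    rw [Finset.sum_comm]
    refine Finset.sum_congr rfl fun j₂ _ => ?_
    rw [Finset.sum_comm]
    refine Finset.sum_congr rfl fun j₃ _ => Finset.sum_congr rfl fun n _ => by ring
  have h2 : starRingEnd ℂ S = -S := by
    rw [h1]
    conv_lhs => rw [Finset.sum_comm]
    rw [← Finset.sum_neg_distrib, map_sum]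
    refine Finset.sum_congr rfl fun p _ => ?_
    rw [← Finset.sum_neg_distrib, map_sum]
    refine Finset.sum_congr rfl fun q _ => ?_
    rw [kernel_swap]
    simp only [map_mul, map_neg, Complex.conj_ofReal, Complex.conj_conj, Complex.ofReal_neg]
    ring
  have h3 := congrArg Complex.re h2
  rw [Complex.conj_re, Complex.neg_re] at h3
  linarith

theorem contDiff_birkhoffField (σ α : ℝ) (N : ℕ) :
    ContDiff ℝ 1 (birkhoffField σ α : EN N → EN N) := by
  refine contDiff_pi.2 fun n => ?_
  unfold birkhoffField
  refine ContDiff.sum fun j₁ _ => ContDiff.sum fun j₂ _ => ContDiff.sum fun j₃ _ => ?_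
  have hc : ContDiff ℝ 1 (fun u : EN N => starRingEnd ℂ (u j₃)) :=
    (Complex.conjCLE.contDiff (n := 1)).comp (contDiff_apply ℝ ℂ j₃)
  exact ((contDiff_const.mul (contDiff_apply ℝ ℂ j₁)).mul (contDiff_apply ℝ ℂ j₂)).mul hc

theorem exists_solution (σ α : ℝ) {N : ℕ} (u : EN N) :
    ∃ γ : ℝ → EN N, γ 0 = u ∧ ∀ t, HasDerivAt γ (birkhoffField σ α (γ t)) t := by
  set r : ℝ := Real.sqrt (∑ n, Complex.normSq (u n)) with hr
  have hr0 : 0 ≤ r := Real.sqrt_nonneg _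
  let χ : ContDiffBump (0 : EN N) := ⟨r + 1, r + 2, by linarith, by linarith⟩
  let f : EN N → EN N := fun v => χ v • birkhoffField σ α v
  have hf : ContDiff ℝ 1 f := χ.contDiff.smul (contDiff_birkhoffField σ α N)
  have hs : HasCompactSupport f := χ.hasCompactSupport.smul_right
  obtain ⟨K, hK⟩ := hf.lipschitzWith_of_hasCompactSupport hs one_ne_zero
  obtain ⟨L, hL⟩ := hs.exists_bound_of_continuous hf.continuous
  obtain ⟨γ, h0, hγ⟩ := exists_global_of_lipschitz (L := L.toNNReal) hK
    (fun x => (hL x).trans (Real.le_coe_toNNReal L)) u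
  have hcons : ∀ t, ∑ n, Complex.normSq (γ t n) = ∑ n, Complex.normSq (u n) := by
    have hd : ∀ t, HasDerivAt (fun s => ∑ n, Complex.normSq (γ s n)) 0 t := by
      intro t
      have hn : ∀ n, HasDerivAt (fun s => Complex.normSq (γ s n))
          (2 * (starRingEnd ℂ (γ t n) * f (γ t) n).re) t := by
        intro n
        have h1 := (hasDerivAt_pi.1 (hγ t)) n
        have hre : HasDerivAt (fun s => (γ s n).re) (f (γ t) n).re t :=
          Complex.reCLM.hasFDerivAt.comp_hasDerivAt t h1
        have him : HasDerivAt (fun s => (γ s n).im) (f (γ t) n).im t :=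
          Complex.imCLM.hasFDerivAt.comp_hasDerivAt t h1
        have h2 := (hre.mul hre).add (him.mul him)
        refine h2.congr_deriv ?_ |>.congr_of_eventuallyEq ?_
        · simp; ring
        · exact Filter.Eventually.of_forall fun s => Complex.normSq_apply _
      have h := HasDerivAt.fun_sum (u := Finset.univ) (fun n _ => hn n)
      refine h.congr_deriv ?_
      rw [← Finset.mul_sum, ← Complex.re_sum]
      have : ∑ n, starRingEnd ℂ (γ t n) * f (γ t) n
          = (χ (γ t) : ℂ) * ∑ n, starRingEnd ℂ (γ t n) * birkhoffField σ α (γ t) n := by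
        rw [Finset.mul_sum]
        refine Finset.sum_congr rfl fun n _ => ?_
        simp only [f, Pi.smul_apply, Complex.real_smul]
        ring
      rw [this, Complex.re_ofReal_mul, re_sum_field]
      simp
    intro t
    have := is_const_of_deriv_eq_zero (fun s => (hd s).differentiableAt) (fun s => (hd s).deriv) t 0
    rw [this, h0]
  refine ⟨γ, h0, fun t => ?_⟩
  have hb : ‖γ t‖ ≤ r := by
    refine (pi_norm_le_iff_of_nonneg hr0).2 fun n => ?_
    refine Real.le_sqrt_of_sq_le ?_
    rw [← hcons t, ← Complex.normSq_eq_norm_sq]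
    exact Finset.single_le_sum (f := fun n => Complex.normSq (γ t n))
      (fun _ _ => Complex.normSq_nonneg _) (Finset.mem_univ n)
  have h1 : χ (γ t) = 1 := χ.one_of_mem_closedBall (by
    rw [mem_closedBall_zero_iff]; show ‖γ t‖ ≤ r + 1; linarith)
  have := hγ t
  simpa only [f, h1, one_smul] using this

theorem exists_birkhoffFlow (σ α : ℝ) (N : ℕ) : ∃ Φ, IsBirkhoffFlow σ α N Φ := by
  choose γ h0 hγ using fun u : EN N => exists_solution σ α u
  exact ⟨fun t u => γ u t, fun u => ⟨h0 u, hγ u⟩⟩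

theorem unique_birkhoffFlow {σ α : ℝ} {N : ℕ} {Φ Ψ : ℝ → EN N → EN N}
    (hΦ : IsBirkhoffFlow σ α N Φ) (hΨ : IsBirkhoffFlow σ α N Ψ) : Φ = Ψ := by
  funext t u
  have hc : ∀ {Θ : ℝ → EN N → EN N}, IsBirkhoffFlow σ α N Θ → Continuous fun s => Θ s u :=
    fun h => continuous_iff_continuousAt.2 fun s => ((h u).2 s).continuousAt
  set S : Set (EN N) := (fun s => Φ s u) '' Set.Icc (-(|t| + 1)) (|t| + 1) ∪
      (fun s => Ψ s u) '' Set.Icc (-(|t| + 1)) (|t| + 1) with hS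
  have hcomp : IsCompact S :=
    (isCompact_Icc.image (hc hΦ)).union (isCompact_Icc.image (hc hΨ))
  obtain ⟨K, hK⟩ := ((contDiff_birkhoffField σ α N).locallyLipschitz.locallyLipschitzOn
    (s := S)).exists_lipschitzOnWith_of_compact hcomp
  have ht : t ∈ Set.Ioo (-(|t| + 1)) (|t| + 1) :=
    ⟨by linarith [neg_abs_le t], by linarith [le_abs_self t]⟩
  have h0 : (0 : ℝ) ∈ Set.Ioo (-(|t| + 1)) (|t| + 1) :=
    ⟨by linarith [abs_nonneg t], by linarith [abs_nonneg t]⟩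
  refine ODE_solution_unique_of_mem_Ioo (v := fun _ => birkhoffField σ α) (s := fun _ => S)
    (K := K) (f := fun s => Φ s u) (g := fun s => Ψ s u) (fun _ _ => hK) h0
    (fun s hs => ⟨(hΦ u).2 s, Or.inl ⟨s, Set.Ioo_subset_Icc_self hs, rfl⟩⟩)
    (fun s hs => ⟨(hΨ u).2 s, Or.inr ⟨s, Set.Ioo_subset_Icc_self hs, rfl⟩⟩) ?_ ht
  simp only [(hΦ u).1, (hΨ u).1]

/-- The truncated Birkhoff flow `Φ^N_t : E_N → E_N`. -/
def birkhoffFlow (σ α : ℝ) (N : ℕ) : ℝ → EN N → EN N := (exists_birkhoffFlow σ α N).choose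

theorem isBirkhoffFlow_birkhoffFlow (σ α : ℝ) (N : ℕ) :
    IsBirkhoffFlow σ α N (birkhoffFlow σ α N) := (exists_birkhoffFlow σ α N).choose_spec

/-- The energy along the truncated Birkhoff flow, `t ↦ H^{(α)}[Φ^N_t (Π_N u)]`. -/
def energyAlongFlow (σ α : ℝ) (N : ℕ) (u : L2T) (t : ℝ) : ℝ :=
  energy σ α (birkhoffFlow σ α N t (proj N u))

/-- `G_N(u) = d/dt H^{(α)}[Φ^N_t (Π_N u)]` at `t = 0`. -/
def energyDerivative (σ α : ℝ) (N : ℕ) (u : L2T) : ℝ := deriv (energyAlongFlow σ α N u) 0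

end BirkhoffNLS

end

noncomputable section

namespace BirkhoffNLS

open MeasureTheory ProbabilityTheory
open scoped ENNReal NNReal

/-! ### The exponent -/

/-! The derivative of the energy splits into a kinetic and a potential part. In the kinetic part,
symmetrising over the four frequencies multiplies the Birkhoff kernel by its own denominator, so
that only a quartic form with bounded coefficients remains (`norm_kinetic_deriv_le`). The potential
part is a sextic form that still contains the kernel. Strong convexity of `|x|^{2α}` on bounded
intervals (`le_abs_resonance`) bounds the kernel by a multiple of `M^{2-2α} / (|a-c| |b-c|)`, where
`M` is the size of the frequencies: the power of `M` costs a few derivatives, while the inverse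
distances are square summable (`abs_kernel_le`, `sum_conv_hilbert_le`).

Let `X` and `Y` be the squared norms of `u` in `H^{7/20}` and `H^{2(1-α)}`. Then `|G_N| ≤ C (X² +
(XY)^{3/2})` uniformly in `N` (`abs_energyPolyDeriv_le`). The index `7/20` lies above `1/3`, the
threshold for the embedding into `L⁶`, and below `3/8`, where the quartic term would reach the
allowed growth `1/ζ(1) = 3/4` at `α = 1`.

The probabilistic input is one Chernoff bound (`gaussianSequence_weighted_sum_ge_le`). For `λ ≥ 1`
the weights `cutoff` lie in `[0, 1]` and have total mass `O(λ)`, so `∑ cutoff(n) |g_n|² = O(λ)`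
outside an event of probability at most `e^{-λ}`. Interpolating with `‖u‖_{L²} ≤ R`
(`weight_rpow_le`) gives `X = O(λ^r)` and `Y = O(λ^{2q})`, where `r = 7/(20α)` and `q = (1-α)/α`.
Hence `G_N` is `O(λ^{max(2r, 3q+3r/2)})`, and both exponents are at most `1/ζ(α)`. Taking `t`
proportional to `λ^{1/ζ(α)}` gives the tail, and the moments follow by integration. The estimates
need only `α > 9/10`; the threshold `(1+√97)/12` is what makes `ζ(α) > 1`. -/

theorem nine_tenths_lt {α : ℝ} (hα : (1 + Real.sqrt 97) / 12 < α) : 9 / 10 < α := by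
  have : (9.8 : ℝ) ≤ Real.sqrt 97 := Real.le_sqrt_of_sq_le (by norm_num)
  linarith

/-- The two entries are separated by `4/3`: the first is at least `4/3` once `α ≥ 4/5`, and the
second is at most `4/3` for `α ≤ 1`, with equality at `α = 1`. -/
theorem zeta_eq {α : ℝ} (hα : 9 / 10 < α) (hα1 : α ≤ 1) :
    zeta α = 2 * α * (α + 1) / (4 - 4 * α ^ 2 + 3 * α) := by
  unfold zeta
  split_ifs with h
  · rfl
  · have h1 : 0 < 1 - α := by
      have := lt_of_le_of_ne hα1 h
      linarith
    refine min_eq_right ?_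
    have h2 : 2 * α * (α + 1) / (4 - 4 * α ^ 2 + 3 * α) ≤ 4 / 3 := by
      rw [div_le_div_iff₀ (by nlinarith) (by norm_num)]
      nlinarith
    have h3 : 1 ≤ (2 * α - 1) / (3 * (1 - α)) := by
      rw [le_div_iff₀ (by linarith)]
      linarith
    linarith

/-- The second entry exceeds `1` exactly when `6α² - α - 4 > 0`, and `(1+√97)/12` is the positive
root of this quadratic. -/
theorem one_lt_zeta {α : ℝ} (hα : (1 + Real.sqrt 97) / 12 < α) (hα1 : α ≤ 1) : 1 < zeta α := by
  have h9 := nine_tenths_lt hα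
  rw [zeta_eq h9 hα1, one_lt_div (by nlinarith)]
  have h := Real.sq_sqrt (show (0 : ℝ) ≤ 97 by norm_num)
  have h0 := Real.sqrt_nonneg 97
  nlinarith

theorem quartic_exponent_le {α : ℝ} (hα : 9 / 10 < α) (hα1 : α ≤ 1) :
    2 * (7 / (20 * α)) ≤ 1 / zeta α := by
  rw [zeta_eq hα hα1, one_div_div, ← mul_div_assoc, div_le_div_iff₀ (by linarith) (by nlinarith)]
  have : 0 ≤ α * (4 * 20 * (1 - α) * (α + 13 / 20) + 4 : ℝ) := by
    have h1 : 0 ≤ 1 - α := by linarith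
    positivity
  nlinarith

theorem sextic_exponent_le {α : ℝ} (hα : 9 / 10 < α) (hα1 : α ≤ 1) :
    3 * ((1 - α) / α) + 3 / 2 * (7 / (20 * α)) ≤ 1 / zeta α := by
  have h0 : 0 < α := by linarith
  have : 3 * ((1 - α) / α) + 3 / 2 * (7 / (20 * α)) = (3 * (1 - α) + 21 / 40) / α := by
    field_simp
    ring
  rw [zeta_eq hα hα1, one_div_div, this, div_le_div_iff₀ h0 (by nlinarith)]
  have : 0 ≤ α * (2 * α ^ 2 + 39 / 20 * α - 61 / 20) := by
    have : 0 ≤ 2 * α ^ 2 + 39 / 20 * α - 61 / 20 := by nlinarith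
    positivity
  nlinarith

/-! ### The resonance function -/

/-- Of two pairs with the same sum, a convex function is larger on the more spread one. -/
theorem add_le_add_of_convexOn {g : ℝ → ℝ} {s : Set ℝ} (hg : ConvexOn ℝ s g) {a b c d : ℝ}
    (ha : a ∈ s) (hb : b ∈ s) (hsum : a + b = c + d) (hc : (c - a) * (c - b) ≤ 0) :
    g c + g d ≤ g a + g b := by
  wlog hab : a ≤ b generalizing a b
  · have := this hb ha (by linarith) (by linarith) (by linarith)
    linarith
  rcases hab.eq_or_lt with rfl | hlt
  · have h1 : c = a := by nlinarith [sq_nonneg (c - a)]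
    have h2 : d = a := by linarith
    rw [h1, h2]
  have hca : a ≤ c := by
    by_contra h
    nlinarith
  have hcb : c ≤ b := by
    by_contra h
    nlinarith
  have hba : 0 < b - a := by linarith
  -- `θ` is the barycentric coordinate of `c` in `[a, b]`; since the sums agree, `d` has the
  -- complementary one, and the two convexity inequalities add up.
  set θ := (c - a) / (b - a) with hθ
  have h0 : 0 ≤ θ := div_nonneg (by linarith) hba.le
  have h1 : θ ≤ 1 := (div_le_one hba).2 (by linarith)
  have hθm : θ * (b - a) = c - a := div_mul_cancel₀ _ hba.ne'
  have hc' : (1 - θ) • a + θ • b = c := by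
    simp only [smul_eq_mul]
    linarith
  have hd' : θ • a + (1 - θ) • b = d := by
    simp only [smul_eq_mul]
    linarith
  have e1 := hg.2 ha hb (sub_nonneg.2 h1) h0 (by ring)
  have e2 := hg.2 ha hb h0 (sub_nonneg.2 h1) (by ring)
  rw [hc'] at e1
  rw [hd'] at e2
  simp only [smul_eq_mul] at e1 e2
  linarith

/-- For `0 < x ≤ M` the second derivative of `x^p` is at least `m = p(p-1)M^{p-2}`, because `p ≤ 2`;
so `x^p - m x²/2` is convex on `[0, M]`. It is also increasing there, so composing it with the
convex function `|x|` keeps it convex across the origin. -/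
theorem convexOn_abs_rpow_sub_sq {p M : ℝ} (hp1 : 1 < p) (hp2 : p ≤ 2) (hM : 0 < M) :
    ConvexOn ℝ (Set.Icc (-M) M)
      (fun x : ℝ => |x| ^ p - p * (p - 1) * M ^ (p - 2) / 2 * x ^ 2) := by
  set m := p * (p - 1) * M ^ (p - 2) with hm
  have hd : ∀ x : ℝ, 0 < x →
      HasDerivAt (fun x : ℝ => x ^ p - m / 2 * x ^ 2) (p * x ^ (p - 1) - m * x) x := by
    intro x hx
    have h1 := Real.hasDerivAt_rpow_const (x := x) (p := p) (Or.inl hx.ne')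
    have h2 := ((hasDerivAt_id x).pow 2).const_mul (m / 2)
    refine (h1.sub h2).congr_deriv ?_
    simp
    ring
  have hd2 : ∀ x : ℝ, 0 < x →
      HasDerivAt (fun x : ℝ => p * x ^ (p - 1) - m * x) (p * ((p - 1) * x ^ (p - 2)) - m) x := by
    intro x hx
    have h1 := (Real.hasDerivAt_rpow_const (x := x) (p := p - 1) (Or.inl hx.ne')).const_mul p
    have h2 := (hasDerivAt_id x).const_mul m
    refine (h1.sub h2).congr_deriv ?_
    rw [show p - 1 - 1 = p - 2 by ring]
    simp
  have hpow : ∀ x : ℝ, 0 < x → x ≤ M → M ^ (p - 2) ≤ x ^ (p - 2) := fun x hx hxM =>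
    Real.rpow_le_rpow_of_nonpos hx hxM (by linarith)
  have hcont : ContinuousOn (fun x : ℝ => x ^ p - m / 2 * x ^ 2) (Set.Icc 0 M) :=
    ((Real.continuous_rpow_const (by linarith)).sub
      (continuous_const.mul (continuous_pow 2))).continuousOn
  have hconv : ConvexOn ℝ (Set.Icc 0 M) (fun x : ℝ => x ^ p - m / 2 * x ^ 2) := by
    refine convexOn_of_hasDerivWithinAt2_nonneg (convex_Icc _ _) hcont
      (f' := fun x => p * x ^ (p - 1) - m * x)
      (f'' := fun x => p * ((p - 1) * x ^ (p - 2)) - m) ?_ ?_ ?_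
    · intro x hx
      rw [interior_Icc] at hx
      exact (hd x hx.1).hasDerivWithinAt
    · intro x hx
      rw [interior_Icc] at hx
      exact (hd2 x hx.1).hasDerivWithinAt
    · intro x hx
      rw [interior_Icc] at hx
      have := hpow x hx.1 hx.2.le
      have h3 : 0 ≤ p * (p - 1) := by nlinarith
      have := mul_le_mul_of_nonneg_left this h3
      rw [hm]
      linarith
  have hmono : MonotoneOn (fun x : ℝ => x ^ p - m / 2 * x ^ 2) (Set.Icc 0 M) := by
    refine monotoneOn_of_deriv_nonneg (convex_Icc _ _) hcont ?_ ?_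
    · intro x hx
      rw [interior_Icc] at hx
      exact (hd x hx.1).differentiableAt.differentiableWithinAt
    · intro x hx
      rw [interior_Icc] at hx
      rw [(hd x hx.1).deriv]
      have h1 := hpow x hx.1 hx.2.le
      have h2 : x ^ (p - 1) = x ^ (p - 2) * x := by
        rw [← Real.rpow_add_one hx.1.ne']
        congr 1
        ring
      have h4 : 0 ≤ M ^ (p - 2) := (Real.rpow_pos_of_pos hM _).le
      -- This uses `p - 1 ≤ 1` together with `M^{p-2} ≤ x^{p-2}`.
      have h3 : m ≤ p * x ^ (p - 2) := by
        rw [hm]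
        nlinarith [mul_nonneg (show 0 ≤ p * (2 - p) by nlinarith) h4]
      rw [h2]
      nlinarith [hx.1]
  have himg : (fun x : ℝ => |x|) '' Set.Icc (-M) M ⊆ Set.Icc 0 M := by
    rintro _ ⟨x, hx, rfl⟩
    exact ⟨abs_nonneg x, abs_le.2 hx⟩
  refine ⟨convex_Icc _ _, fun x hx y hy s t hs ht hst => ?_⟩
  have hx' := himg ⟨x, hx, rfl⟩
  have hy' := himg ⟨y, hy, rfl⟩
  have hc := hconv.2 hx' hy' hs ht hst
  have hmem := convex_Icc (0 : ℝ) M hx' hy' hs ht hst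
  have hxy := convex_Icc (-M) M hx hy hs ht hst
  have hle : |s • x + t • y| ≤ s • |x| + t • |y| := by
    refine (abs_add_le _ _).trans (le_of_eq ?_)
    simp only [smul_eq_mul]
    rw [abs_mul, abs_mul, abs_of_nonneg hs, abs_of_nonneg ht]
  have := (hmono (himg ⟨_, hxy, rfl⟩) hmem hle).trans hc
  simpa only [sq_abs] using this

/-- Lower bound for the resonance function of a dispersion relation `|x| ^ p`, `1 < p ≤ 2`. -/
theorem le_abs_resonance {p M a b c d : ℝ} (hp1 : 1 < p) (hp2 : p ≤ 2) (hM : 0 < M)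
    (ha : |a| ≤ M) (hb : |b| ≤ M) (hc : |c| ≤ M) (hd : |d| ≤ M) (hsum : a + b = c + d) :
    p * (p - 1) * M ^ (p - 2) * (|a - c| * |b - c|) ≤
        |(|a| ^ p + |b| ^ p - |c| ^ p - |d| ^ p)| := by
  have hg := convexOn_abs_rpow_sub_sq hp1 hp2 hM
  set m := p * (p - 1) * M ^ (p - 2) with hm
  have hd' : d = a + b - c := by linarith
  rw [← abs_mul]
  -- Either `c` lies between `a` and `b`, or `a` lies between `c` and `d`. In both cases convexity
  -- signs the part left after removing the square, and the quadratic part contributes exactly `m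
  -- |a-c| |b-c|`, since `a² + b² - c² - d² = -2(c-a)(c-b)`.
  rcases le_total ((c - a) * (c - b)) 0 with h | h
  · have := add_le_add_of_convexOn hg (abs_le.1 ha) (abs_le.1 hb) hsum h
    rw [show (a - c) * (b - c) = (c - a) * (c - b) by ring, abs_of_nonpos h]
    refine le_trans ?_ (le_abs_self _)
    have e : a ^ 2 + b ^ 2 - c ^ 2 - d ^ 2 = -2 * ((c - a) * (c - b)) := by rw [hd']; ring
    linear_combination this - m / 2 * e
  · have h' : (a - c) * (a - d) ≤ 0 := by
      rw [hd']
      nlinarith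
    have := add_le_add_of_convexOn hg (abs_le.1 hc) (abs_le.1 hd) hsum.symm h'
    rw [show (a - c) * (b - c) = (c - a) * (c - b) by ring, abs_of_nonneg h]
    refine le_trans ?_ (neg_le_abs _)
    have e : a ^ 2 + b ^ 2 - c ^ 2 - d ^ 2 = -2 * ((c - a) * (c - b)) := by rw [hd']; ring
    linear_combination this + m / 2 * e

/-- The weight `1 + |n|^{2α}`. -/
def weight (α : ℝ) (n : ℤ) : ℝ := 1 + disp α n

theorem disp_nonneg (α : ℝ) (n : ℤ) : 0 ≤ disp α n := Real.rpow_nonneg (abs_nonneg _) _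

theorem one_le_weight (α : ℝ) (n : ℤ) : 1 ≤ weight α n := by
  have := disp_nonneg α n
  unfold weight
  linarith

theorem weight_pos (α : ℝ) (n : ℤ) : 0 < weight α n := zero_lt_one.trans_le (one_le_weight α n)

theorem abs_rpow_le_weight {α : ℝ} (h0 : 0 < α) (h1 : α ≤ 1) (n : ℤ) :
    |(n : ℝ)| ^ (2 - 2 * α) ≤ weight α n ^ ((1 - α) / α) := by
  have : |(n : ℝ)| ^ (2 - 2 * α) = disp α n ^ ((1 - α) / α) := by
    rw [disp, ← Real.rpow_mul (abs_nonneg _)]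
    congr 1
    field_simp
  rw [this]
  exact Real.rpow_le_rpow (disp_nonneg _ _) (by unfold weight; linarith)
    (div_nonneg (by linarith) h0.le)

/-- The resonance bound applies with exponent `2α` and `M = |a| + |b| + |c|`, which also dominates
`|d|`. The loss `M^{2-2α}` is subadditive in the frequencies, and a sum of three numbers `≥ 1` is at
most three times their product. All the loss thus falls on `a, b, c` and none on `d`. -/
theorem abs_kernel_le {σ α : ℝ} (hσ : |σ| = 1) (h0 : 9 / 10 < α) (h1 : α ≤ 1) (a b c d : ℤ) :
    |kernel σ α a b c d| ≤ if a + b = c + d then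
      3 * (weight α a ^ ((1 - α) / α) * weight α b ^ ((1 - α) / α) * weight α c ^ ((1 - α) / α)) *
        (|(a - c : ℝ)|⁻¹ * |(b - c : ℝ)|⁻¹) else 0 := by
  have hα : 0 < α := by linarith
  have hw : ∀ n, 1 ≤ weight α n ^ ((1 - α) / α) := fun n =>
    Real.one_le_rpow (one_le_weight α n) (div_nonneg (by linarith) hα.le)
  have hw0 : ∀ n, 0 ≤ weight α n ^ ((1 - α) / α) := fun n => zero_le_one.trans (hw n)
  unfold kernel
  by_cases hs : a + b = c + d
  swap
  · rw [if_neg (fun h => hs h.1), if_neg hs, abs_zero]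
  rw [if_pos hs]
  split_ifs with h
  swap
  · rw [abs_zero]
    have := hw0 a; have := hw0 b; have := hw0 c
    positivity
  obtain ⟨-, hne⟩ := h
  -- Where `a = c` or `b = c` the kernel vanishes, in agreement with the right-hand side, which is
  -- `0` there by `0⁻¹ = 0`.
  have hac : a ≠ c := by
    rintro rfl
    have : b = d := by linarith
    exact hne (by rw [this])
  have hbc : b ≠ c := by
    rintro rfl
    have : a = d := by linarith
    exact hne (by rw [this, add_comm])
  have hacr : 0 < |(a - c : ℝ)| := abs_pos.2 (sub_ne_zero.2 (by exact_mod_cast hac))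
  have hbcr : 0 < |(b - c : ℝ)| := abs_pos.2 (sub_ne_zero.2 (by exact_mod_cast hbc))
  set A := |(a : ℝ)|
  set B := |(b : ℝ)|
  set D := |(c : ℝ)|
  have hA : 0 ≤ A := abs_nonneg _
  have hB : 0 ≤ B := abs_nonneg _
  have hD : 0 ≤ D := abs_nonneg _
  have hsr : (a : ℝ) + b = c + d := by exact_mod_cast hs
  have hd : |(d : ℝ)| ≤ A + B + D := by
    have e : (d : ℝ) = a + b - c := by linarith
    rw [e]
    exact (abs_sub _ _).trans (by linarith [abs_add_le (a : ℝ) b])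
  have hM : 0 < A + B + D := by
    have := abs_sub (a : ℝ) c
    linarith
  have key := le_abs_resonance (p := 2 * α) (by linarith) (by linarith) hM
    (show |(a : ℝ)| ≤ A + B + D by linarith) (show |(b : ℝ)| ≤ A + B + D by linarith)
    (show |(c : ℝ)| ≤ A + B + D by linarith) hd hsr
  set M := A + B + D with hMdef
  have hMp : 0 < M ^ (2 * α - 2) := Real.rpow_pos_of_pos hM _
  -- The constant `p(p-1)` at `p = 2α` is at least `1`, so it can be dropped.
  have hα2 : 1 ≤ 2 * α * (2 * α - 1) := by nlinarith
  have key2 : M ^ (2 * α - 2) * (|(a - c : ℝ)| * |(b - c : ℝ)|) ≤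
      |disp α a + disp α b - disp α c - disp α d| := by
    refine le_trans ?_ key
    refine mul_le_mul_of_nonneg_right ?_ (by positivity)
    nlinarith
  rw [abs_div, abs_neg, hσ]
  have hMle : M ^ (2 - 2 * α) ≤ 3 * (weight α a ^ ((1 - α) / α) * weight α b ^ ((1 - α) / α) *
      weight α c ^ ((1 - α) / α)) := by
    have e0 : 0 ≤ 2 - 2 * α := by linarith
    have e1 : 2 - 2 * α ≤ 1 := by linarith
    have s1 := Real.rpow_add_le_add_rpow (add_nonneg hA hB) hD e0 e1
    have s2 := Real.rpow_add_le_add_rpow hA hB e0 e1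
    have t1 := abs_rpow_le_weight hα h1 a
    have t2 := abs_rpow_le_weight hα h1 b
    have t3 := abs_rpow_le_weight hα h1 c
    have w1 := hw a
    have w2 := hw b
    have w3 := hw c
    set x := weight α a ^ ((1 - α) / α)
    set y := weight α b ^ ((1 - α) / α)
    set z := weight α c ^ ((1 - α) / α)
    have xy : 1 ≤ x * y := one_le_mul_of_one_le_of_one_le w1 w2
    have yz : 1 ≤ y * z := one_le_mul_of_one_le_of_one_le w2 w3
    have xz : 1 ≤ x * z := one_le_mul_of_one_le_of_one_le w1 w3
    have l1 : x ≤ x * y * z := by nlinarith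
    have l2 : y ≤ x * y * z := by nlinarith
    have l3 : z ≤ x * y * z := by nlinarith
    calc M ^ (2 - 2 * α) ≤ A ^ (2 - 2 * α) + B ^ (2 - 2 * α) + D ^ (2 - 2 * α) := by linarith
      _ ≤ x + y + z := by linarith
      _ ≤ _ := by linarith
  calc 1 / |disp α a + disp α b - disp α c - disp α d|
      ≤ 1 / (M ^ (2 * α - 2) * (|(a - c : ℝ)| * |(b - c : ℝ)|)) :=
        one_div_le_one_div_of_le (by positivity) key2
    _ = M ^ (2 - 2 * α) * (|(a - c : ℝ)|⁻¹ * |(b - c : ℝ)|⁻¹) := by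
        rw [one_div, mul_inv, mul_inv, ← Real.rpow_neg hM.le]
        congr 2
        ring
    _ ≤ _ := mul_le_mul_of_nonneg_right hMle (by positivity)

/-! ### Sums over `a + b = c + d` -/

/-- The indicator of `a + b = c + d`. -/
def conv (a b c d : ℤ) : ℝ := if a + b = c + d then 1 else 0

theorem conv_nonneg (a b c d : ℤ) : 0 ≤ conv a b c d := by
  unfold conv
  split_ifs <;> norm_num

theorem conv_comm_left (a b c d : ℤ) : conv a b c d = conv b a c d := by
  unfold conv
  rw [add_comm a b]

theorem conv_comm_right (a b c d : ℤ) : conv a b c d = conv a b d c := by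
  unfold conv
  rw [add_comm c d]

theorem conv_swap (a b c d : ℤ) : conv a b c d = conv c d a b := by
  unfold conv
  simp only [eq_comm]

variable {N : ℕ}

/-- Three frequencies determine the fourth, which may fall outside the band; hence an inequality. -/
theorem sum_conv_le_one (a b c : ℤ) : ∑ d : Modes N, conv a b c d ≤ 1 := by
  have h : ∀ d : Modes N, conv a b c d ≤
      ∑ x ∈ {a + b - c}, if (d : ℤ) = x then (1 : ℝ) else 0 := by
    intro d
    rw [Finset.sum_singleton]
    unfold conv
    split_ifs with h1 h2 <;> first | (exfalso; omega) | norm_num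
  refine (Finset.sum_le_sum fun d _ => h d).trans ?_
  simp only [Finset.sum_singleton]
  by_cases hm : a + b - c ∈ Finset.Icc (-(N : ℤ)) N
  · rw [Finset.sum_eq_single (⟨a + b - c, hm⟩ : Modes N)]
    · simp
    · intro d _ hd
      rw [if_neg fun h => hd (Subtype.ext h)]
    · simp
  · refine (Finset.sum_nonpos fun d _ => ?_).trans zero_le_one
    rw [if_neg]
    intro h
    exact hm (h ▸ d.2)

/-- Summing `X (a, b, c)` over the solutions of `a + b = c + d` with `|d| ≤ N`. -/
theorem sum_conv_mul_le {X : Modes N → Modes N → Modes N → ℝ} (hX : ∀ a b c, 0 ≤ X a b c) :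
    ∑ a : Modes N, ∑ b : Modes N, ∑ c : Modes N, ∑ d : Modes N, conv a b c d * X a b c ≤
        ∑ a : Modes N, ∑ b : Modes N, ∑ c : Modes N, X a b c := by
  refine Finset.sum_le_sum fun a _ => Finset.sum_le_sum fun b _ => Finset.sum_le_sum fun c _ => ?_
  rw [← Finset.sum_mul]
  exact mul_le_of_le_one_left (hX a b c) (sum_conv_le_one _ _ _)

/-- The sum over `c, d` put in front of the sum over `a, b`. -/
theorem sum_sum_comm (F : Modes N → Modes N → Modes N → Modes N → ℝ) :
    ∑ a : Modes N, ∑ b : Modes N, ∑ c : Modes N, ∑ d : Modes N, F a b c d = ∑ c : Modes N,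
        ∑ d : Modes N, ∑ a : Modes N, ∑ b : Modes N, F a b c d := by
  have h : ∀ G : Modes N → Modes N → Modes N → Modes N → ℝ,
      ∑ a : Modes N, ∑ b : Modes N, ∑ c : Modes N, ∑ d : Modes N, G a b c d
        = ∑ p : Modes N × Modes N, ∑ q : Modes N × Modes N, G p.1 p.2 q.1 q.2 := by
    intro G
    simp only [Fintype.sum_prod_type]
  rw [h, Finset.sum_comm, h fun c d a b => F a b c d]

theorem sum_sum_sum_mul (A B C : Modes N → ℝ) :
    ∑ a : Modes N, ∑ b : Modes N, ∑ c : Modes N, A a * B b * C c = (∑ a : Modes N,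
        A a) * (∑ b : Modes N, B b) * ∑ c : Modes N, C c := by
  simp only [← Finset.mul_sum, ← Finset.sum_mul]

theorem sum_conv_mul_mul_mul_le {A B C : Modes N → ℝ} (hA : ∀ n, 0 ≤ A n) (hB : ∀ n, 0 ≤ B n)
    (hC : ∀ n, 0 ≤ C n) :
    ∑ a : Modes N, ∑ b : Modes N, ∑ c : Modes N, ∑ d : Modes N, conv a b c d * (A a * B b * C c) ≤
      (∑ a : Modes N, A a) * (∑ b : Modes N, B b) * ∑ c : Modes N, C c := by
  rw [← sum_sum_sum_mul]
  exact sum_conv_mul_le (X := fun a b c => A a * B b * C c)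
    fun a b c => mul_nonneg (mul_nonneg (hA a) (hB b)) (hC c)

/-- `∑ f(a) f(b) f(c) f(d)` over `a + b = c + d`. -/
def quarticSum (f : Modes N → ℝ) : ℝ :=
  ∑ a : Modes N, ∑ b : Modes N, ∑ c : Modes N, ∑ d : Modes N, conv a b c d * (f a * f b * f c * f d)

/-- `∑ f(a) f(b) f(c)` over `a + b = c + d`, as a function of `d`. -/
def cubicSum (f : Modes N → ℝ) (d : Modes N) : ℝ :=
  ∑ a : Modes N, ∑ b : Modes N, ∑ c : Modes N, conv a b c d * (f a * f b * f c)

/-- An elementary form of the embedding into `L⁴`. By the arithmetic-geometric mean inequality the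
product of four `f` is at most the mean of `A_a A_b s_c² s_d²` and `A_c A_d s_a² s_b²`. Then `s_c²
s_d² ≤ (s_c³ + s_d³)/2`, as `s ≤ 1`. Each resulting term involves only three frequencies, so the
fourth sum is absorbed by `conv`. -/
theorem quarticSum_le {s A f : Modes N → ℝ} (hs : ∀ n, 0 ≤ s n) (hs1 : ∀ n, s n ≤ 1)
    (hA : ∀ n, 0 ≤ A n) (hf : ∀ n, f n ^ 2 = A n * s n ^ 2) :
    quarticSum f ≤ (∑ n : Modes N, s n ^ 3) * (∑ n : Modes N, A n) ^ 2 := by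
  have hs4 : ∀ n, s n ^ 4 ≤ s n ^ 3 := fun n =>
    pow_le_pow_of_le_one (hs n) (hs1 n) (by norm_num)
  have h3 : ∀ n, 0 ≤ s n ^ 3 := fun n => pow_nonneg (hs n) 3
  have key : ∀ a b c d : Modes N, conv a b c d * (f a * f b * f c * f d) ≤
      1 / 4 * (conv a b c d * (A a * A b * s c ^ 3)) +
      1 / 4 * (conv a b c d * (A a * A b * s d ^ 3)) +
      1 / 4 * (conv a b c d * (A c * A d * s a ^ 3)) +
      1 / 4 * (conv a b c d * (A c * A d * s b ^ 3)) := by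
    intro a b c d
    have h0 := conv_nonneg a b c d
    suffices h : f a * f b * f c * f d ≤ 1 / 4 * (A a * A b * s c ^ 3 + A a * A b * s d ^ 3 +
        A c * A d * s a ^ 3 + A c * A d * s b ^ 3) by
      refine (mul_le_mul_of_nonneg_left h h0).trans (le_of_eq ?_)
      ring
    have e1 : f a * f b * f c * f d ≤
        1 / 2 * ((A a * A b) * (s c ^ 2 * s d ^ 2) + (A c * A d) * (s a ^ 2 * s b ^ 2)) := by
      have hsq : (f a * f b * f c * f d) ^ 2 =
          ((A a * A b) * (s c ^ 2 * s d ^ 2)) * ((A c * A d) * (s a ^ 2 * s b ^ 2)) := by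
        rw [mul_pow, mul_pow, mul_pow, hf, hf, hf, hf]
        ring
      set x := (A a * A b) * (s c ^ 2 * s d ^ 2) with hx
      set y := (A c * A d) * (s a ^ 2 * s b ^ 2) with hy
      have hx0 : 0 ≤ x := mul_nonneg (mul_nonneg (hA a) (hA b)) (by positivity)
      have hy0 : 0 ≤ y := mul_nonneg (mul_nonneg (hA c) (hA d)) (by positivity)
      refine abs_le_of_sq_le_sq' ?_ (by linarith) |>.2
      rw [hsq]
      nlinarith [sq_nonneg (x - y)]
    have e2 : ∀ x y : Modes N, s x ^ 2 * s y ^ 2 ≤ 1 / 2 * (s x ^ 3 + s y ^ 3) := by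
      intro x y
      nlinarith [sq_nonneg (s x ^ 2 - s y ^ 2), hs4 x, hs4 y]
    have e3 := mul_le_mul_of_nonneg_left (e2 c d) (mul_nonneg (hA a) (hA b))
    have e4 := mul_le_mul_of_nonneg_left (e2 a b) (mul_nonneg (hA c) (hA d))
    linarith
  have b1 := sum_conv_mul_mul_mul_le hA hA h3
  have b2 : ∑ a : Modes N, ∑ b : Modes N, ∑ c : Modes N, ∑ d : Modes N,
      conv a b c d * (A a * A b * s d ^ 3) ≤
      (∑ n : Modes N, A n) * (∑ n : Modes N, A n) * ∑ n : Modes N, s n ^ 3 := by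
    refine le_trans (le_of_eq ?_) b1
    refine Finset.sum_congr rfl fun a _ => Finset.sum_congr rfl fun b _ => ?_
    rw [Finset.sum_comm]
    simp only [conv_comm_right (a : ℤ) b]
  have b3 : ∑ a : Modes N, ∑ b : Modes N, ∑ c : Modes N, ∑ d : Modes N,
      conv a b c d * (A c * A d * s a ^ 3) ≤
      (∑ n : Modes N, A n) * (∑ n : Modes N, A n) * ∑ n : Modes N, s n ^ 3 := by
    refine le_trans (le_of_eq ?_) b1
    rw [sum_sum_comm]
    simp only [conv_swap]
  have b4 : ∑ a : Modes N, ∑ b : Modes N, ∑ c : Modes N, ∑ d : Modes N,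
      conv a b c d * (A c * A d * s b ^ 3) ≤
      (∑ n : Modes N, A n) * (∑ n : Modes N, A n) * ∑ n : Modes N, s n ^ 3 := by
    refine le_trans (le_of_eq ?_) b3
    rw [Finset.sum_comm]
    refine Finset.sum_congr rfl fun a _ => Finset.sum_congr rfl fun b _ =>
      Finset.sum_congr rfl fun c _ => Finset.sum_congr rfl fun d _ => ?_
    rw [conv_comm_left]
  have hsum : quarticSum f ≤ _ := Finset.sum_le_sum fun a _ => Finset.sum_le_sum fun b _ =>
    Finset.sum_le_sum fun c _ => Finset.sum_le_sum fun d _ => key a b c d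
  refine hsum.trans ?_
  simp only [Finset.sum_add_distrib, ← Finset.mul_sum]
  nlinarith

/-- The arithmetic-geometric mean inequality for the three products `s_a s_b`, `s_b s_c`, `s_a s_c`
leaves terms in two frequencies only; with `d` fixed, these determine the third. -/
theorem sum_conv_mul_sq_le {s : Modes N → ℝ} (hs : ∀ n, 0 ≤ s n) (d : Modes N) :
    ∑ a : Modes N, ∑ b : Modes N, ∑ c : Modes N, conv a b c d * (s a ^ 2 * s b ^ 2 * s c ^ 2)
      ≤ (∑ n : Modes N, s n ^ 3) ^ 2 := by
  set S := ∑ n : Modes N, s n ^ 3 with hS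
  have h3 : ∀ n, 0 ≤ s n ^ 3 := fun n => pow_nonneg (hs n) 3
  have hpt : ∀ a b c : Modes N, conv a b c d * (s a ^ 2 * s b ^ 2 * s c ^ 2) ≤
      1 / 3 * (conv a b c d * (s a ^ 3 * s b ^ 3)) +
      1 / 3 * (conv a b c d * (s b ^ 3 * s c ^ 3)) +
      1 / 3 * (conv a b c d * (s a ^ 3 * s c ^ 3)) := by
    intro a b c
    suffices h : s a ^ 2 * s b ^ 2 * s c ^ 2 ≤
        1 / 3 * (s a ^ 3 * s b ^ 3 + s b ^ 3 * s c ^ 3 + s a ^ 3 * s c ^ 3) by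
      refine (mul_le_mul_of_nonneg_left h (conv_nonneg a b c d)).trans (le_of_eq ?_)
      ring
    have amgm : ∀ x y z : ℝ, 0 ≤ x → 0 ≤ y → 0 ≤ z →
        x * y * z ≤ 1 / 3 * (x ^ 3 + y ^ 3 + z ^ 3) := by
      intro x y z hx hy hz
      have := mul_nonneg (add_nonneg (add_nonneg hx hy) hz)
        (add_nonneg (add_nonneg (sq_nonneg (x - y)) (sq_nonneg (y - z))) (sq_nonneg (x - z)))
      nlinarith
    refine le_trans (le_of_eq ?_) ((amgm (s a * s b) (s b * s c) (s a * s c)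
      (mul_nonneg (hs a) (hs b)) (mul_nonneg (hs b) (hs c)) (mul_nonneg (hs a) (hs c))).trans
        (le_of_eq ?_)) <;> ring
  have hp : ∑ x : Modes N, ∑ y : Modes N, s x ^ 3 * s y ^ 3 = S ^ 2 := by
    rw [← Finset.sum_mul_sum, sq]
  have b1 : ∑ a : Modes N, ∑ b : Modes N, ∑ c : Modes N, conv a b c d * (s a ^ 3 * s b ^ 3) ≤
      S ^ 2 := by
    rw [← hp]
    refine Finset.sum_le_sum fun a _ => Finset.sum_le_sum fun b _ => ?_
    rw [← Finset.sum_mul]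
    refine mul_le_of_le_one_left (mul_nonneg (h3 a) (h3 b)) ?_
    simp only [conv_comm_right (a : ℤ) b _ d]
    exact sum_conv_le_one _ _ _
  have b2 : ∑ a : Modes N, ∑ b : Modes N, ∑ c : Modes N, conv a b c d * (s b ^ 3 * s c ^ 3) ≤
      S ^ 2 := by
    rw [← hp, Finset.sum_comm]
    refine Finset.sum_le_sum fun b _ => ?_
    rw [Finset.sum_comm]
    refine Finset.sum_le_sum fun c _ => ?_
    rw [← Finset.sum_mul]
    refine mul_le_of_le_one_left (mul_nonneg (h3 b) (h3 c)) ?_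
    simp only [conv_comm_left _ (b : ℤ), conv_swap (b : ℤ)]
    exact sum_conv_le_one _ _ _
  have b3 : ∑ a : Modes N, ∑ b : Modes N, ∑ c : Modes N, conv a b c d * (s a ^ 3 * s c ^ 3) ≤
      S ^ 2 := by
    rw [← hp]
    refine Finset.sum_le_sum fun a _ => ?_
    rw [Finset.sum_comm]
    refine Finset.sum_le_sum fun c _ => ?_
    rw [← Finset.sum_mul]
    refine mul_le_of_le_one_left (mul_nonneg (h3 a) (h3 c)) ?_
    simp only [conv_swap (a : ℤ)]
    exact sum_conv_le_one _ _ _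
  refine (Finset.sum_le_sum fun a _ => Finset.sum_le_sum fun b _ =>
    Finset.sum_le_sum fun c _ => hpt a b c).trans ?_
  simp only [Finset.sum_add_distrib, ← Finset.mul_sum]
  linarith

/-- An elementary form of the embedding into `L⁶`. For each `d`, Cauchy–Schwarz separates `s²` from
`A`; the factor with `s` is bounded uniformly in `d`, and summing the other over `d` removes the
constraint. -/
theorem sum_sq_cubicSum_le {s A f : Modes N → ℝ} (hs : ∀ n, 0 ≤ s n)
    (hA : ∀ n, 0 ≤ A n) (hf : ∀ n, f n ^ 2 = A n * s n ^ 2) :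
    ∑ d : Modes N, cubicSum f d ^ 2 ≤ (∑ n : Modes N, s n ^ 3) ^ 2 * (∑ n : Modes N, A n) ^ 3 := by
  set S := ∑ n : Modes N, s n ^ 3 with hS
  have hcs : ∀ d : Modes N, cubicSum f d ^ 2 ≤
      S ^ 2 * ∑ a : Modes N, ∑ b : Modes N, ∑ c : Modes N, conv a b c d * (A a * A b * A c) := by
    intro d
    have hpt : ∀ a b c : Modes N, (conv a b c d * (f a * f b * f c)) ^ 2 =
        conv a b c d * (s a ^ 2 * s b ^ 2 * s c ^ 2) * (conv a b c d * (A a * A b * A c)) := by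
      intro a b c
      have e : (conv a b c d * (f a * f b * f c)) ^ 2 =
          conv a b c d ^ 2 * (f a ^ 2 * f b ^ 2 * f c ^ 2) := by ring
      rw [e, hf, hf, hf]
      ring
    have h := Finset.sum_sq_le_sum_mul_sum_of_sq_le_mul
      (Finset.univ : Finset (Modes N × Modes N × Modes N))
      (r := fun x => conv x.1 x.2.1 x.2.2 d * (f x.1 * f x.2.1 * f x.2.2))
      (f := fun x => conv x.1 x.2.1 x.2.2 d * (s x.1 ^ 2 * s x.2.1 ^ 2 * s x.2.2 ^ 2))
      (g := fun x => conv x.1 x.2.1 x.2.2 d * (A x.1 * A x.2.1 * A x.2.2))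
      (fun x _ => mul_nonneg (conv_nonneg _ _ _ _) (by positivity))
      (fun x _ => mul_nonneg (conv_nonneg _ _ _ _)
        (mul_nonneg (mul_nonneg (hA _) (hA _)) (hA _)))
      (fun x _ => (hpt _ _ _).le)
    simp only [Fintype.sum_prod_type] at h
    refine h.trans (mul_le_mul_of_nonneg_right (sum_conv_mul_sq_le hs d) ?_)
    exact Finset.sum_nonneg fun a _ => Finset.sum_nonneg fun b _ => Finset.sum_nonneg fun c _ =>
      mul_nonneg (conv_nonneg _ _ _ _) (mul_nonneg (mul_nonneg (hA _) (hA _)) (hA _))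
  calc ∑ d : Modes N, cubicSum f d ^ 2
      ≤ ∑ d : Modes N, S ^ 2 * ∑ a : Modes N, ∑ b : Modes N, ∑ c : Modes N,
          conv a b c d * (A a * A b * A c) :=
        Finset.sum_le_sum fun d _ => hcs d
    _ = S ^ 2 * ∑ a : Modes N, ∑ b : Modes N, ∑ c : Modes N, ∑ d : Modes N,
        conv a b c d * (A a * A b * A c) := by
        rw [← Finset.mul_sum]
        congr 1
        exact Finset.sum_comm.trans (Finset.sum_congr rfl fun a _ =>
          Finset.sum_comm.trans (Finset.sum_congr rfl fun b _ => Finset.sum_comm))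
    _ ≤ S ^ 2 * ((∑ n : Modes N, A n) * (∑ n : Modes N, A n) * ∑ n : Modes N, A n) :=
        mul_le_mul_of_nonneg_left (sum_conv_mul_mul_mul_le hA hA hA) (sq_nonneg S)
    _ = _ := by ring

/-- `∑_{k ≠ 0} k⁻²`. -/
def sumInvSq : ℝ := ∑' k : ℤ, (|(k : ℝ)|⁻¹) ^ 2

theorem summable_invSq : Summable fun k : ℤ => (|(k : ℝ)|⁻¹) ^ 2 := by
  refine (Real.summable_abs_int_rpow (b := 2) (by norm_num)).congr fun k => ?_
  rw [Real.rpow_neg (abs_nonneg _), inv_pow]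
  norm_cast

theorem sumInvSq_nonneg : 0 ≤ sumInvSq := tsum_nonneg fun _ => by positivity

theorem sum_invSq_sub_le (c : ℤ) : ∑ a : Modes N, (|((a : ℤ) - c : ℝ)|⁻¹) ^ 2 ≤ sumInvSq := by
  have hinj : Function.Injective fun a : Modes N => (a : ℤ) - c := fun a b h =>
    Subtype.ext (by simpa using h)
  have h := tsum_comp_le_tsum_of_inj summable_invSq (fun _ => by positivity) hinj
  rw [tsum_fintype] at h
  refine le_trans (le_of_eq ?_) h
  simp [Function.comp]

/-- Discrete Hilbert-type inequality for the resonance kernel. -/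
theorem sum_conv_hilbert_le {v W : Modes N → ℝ} :
    (∑ a : Modes N, ∑ b : Modes N, ∑ c : Modes N, ∑ d : Modes N,
        conv a b c d * (v a * v b * v c * W d *
      (|((a : ℤ) - (c : ℤ) : ℝ)|⁻¹ * |((b : ℤ) - (c : ℤ) : ℝ)|⁻¹))) ^ 2 ≤
      sumInvSq ^ 2 * (∑ n : Modes N, v n ^ 2) ^ 3 * ∑ n : Modes N, W n ^ 2 := by
  set Z := sumInvSq
  have hZ : 0 ≤ Z := sumInvSq_nonneg
  set h : Modes N → Modes N → ℝ := fun a c => |((a : ℤ) - (c : ℤ) : ℝ)|⁻¹ with hh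
  have h0 : ∀ a c, 0 ≤ h a c := fun a c => by positivity
  have hsymm : ∀ a c, h a c = h c a := fun a c => by simp only [hh, abs_sub_comm]
  have hsum : ∀ c, ∑ a : Modes N, h a c ^ 2 ≤ Z := fun c => sum_invSq_sub_le _
  have hsum' : ∀ c, ∑ a : Modes N, h c a ^ 2 ≤ Z := fun c => by
    simp only [hsymm c]
    exact hsum c
  have hprod : ∀ a b c, h a c * h b c ≤ 1 / 2 * (h a c ^ 2 + h b c ^ 2) := fun a b c => by
    nlinarith [sq_nonneg (h a c - h b c)]
  set V := ∑ n : Modes N, v n ^ 2 with hV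
  have hV0 : 0 ≤ V := Finset.sum_nonneg fun n _ => sq_nonneg _
  set T := ∑ n : Modes N, W n ^ 2 with hT
  have hT0 : 0 ≤ T := Finset.sum_nonneg fun n _ => sq_nonneg _
  -- Cauchy–Schwarz with respect to the weight `conv · h · h` separates `v_a v_b` from `v_c W_d`. In
  -- the first factor `c` is summed with `a, b` fixed; in the second, `a` and `b` are summed with
  -- `c, d` fixed, and either one determines the other.
  have hcs := Finset.sum_sq_le_sum_mul_sum_of_sq_le_mul
      (Finset.univ : Finset (Modes N × Modes N × Modes N × Modes N))
      (r := fun x => conv x.1 x.2.1 x.2.2.1 x.2.2.2 * (v x.1 * v x.2.1 * v x.2.2.1 * W x.2.2.2 *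
        (h x.1 x.2.2.1 * h x.2.1 x.2.2.1)))
      (f := fun x => conv x.1 x.2.1 x.2.2.1 x.2.2.2 * (v x.1 ^ 2 * v x.2.1 ^ 2 *
        (h x.1 x.2.2.1 * h x.2.1 x.2.2.1)))
      (g := fun x => conv x.1 x.2.1 x.2.2.1 x.2.2.2 * (v x.2.2.1 ^ 2 * W x.2.2.2 ^ 2 *
        (h x.1 x.2.2.1 * h x.2.1 x.2.2.1)))
      (fun x _ => mul_nonneg (conv_nonneg _ _ _ _)
        (mul_nonneg (by positivity) (mul_nonneg (h0 _ _) (h0 _ _))))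
      (fun x _ => mul_nonneg (conv_nonneg _ _ _ _)
        (mul_nonneg (by positivity) (mul_nonneg (h0 _ _) (h0 _ _))))
      (fun x _ => le_of_eq (by ring))
  simp only [Fintype.sum_prod_type] at hcs
  have b1 : ∑ a : Modes N, ∑ b : Modes N, ∑ c : Modes N, ∑ d : Modes N,
      conv a b c d * (v a ^ 2 * v b ^ 2 * (h a c * h b c)) ≤ Z * V ^ 2 := by
    refine (sum_conv_mul_le (X := fun a b c => v a ^ 2 * v b ^ 2 * (h a c * h b c))
      fun a b c => mul_nonneg (by positivity) (mul_nonneg (h0 _ _) (h0 _ _))).trans ?_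
    have : Z * V ^ 2 = ∑ a : Modes N, ∑ b : Modes N, v a ^ 2 * v b ^ 2 * Z := by
      simp only [← Finset.mul_sum, ← Finset.sum_mul]
      ring
    rw [this]
    refine Finset.sum_le_sum fun a _ => Finset.sum_le_sum fun b _ => ?_
    rw [← Finset.mul_sum]
    refine mul_le_mul_of_nonneg_left ?_ (by positivity)
    refine (Finset.sum_le_sum fun c _ => hprod a b c).trans ?_
    rw [← Finset.mul_sum, Finset.sum_add_distrib]
    linarith [hsum' a, hsum' b]
  have b2 : ∑ a : Modes N, ∑ b : Modes N, ∑ c : Modes N, ∑ d : Modes N,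
      conv a b c d * (v c ^ 2 * W d ^ 2 * (h a c * h b c)) ≤ Z * V * T := by
    rw [sum_sum_comm]
    have : Z * V * T = ∑ c : Modes N, ∑ d : Modes N, v c ^ 2 * W d ^ 2 * Z := by
      simp only [← Finset.mul_sum, ← Finset.sum_mul]
      ring
    rw [this]
    refine Finset.sum_le_sum fun c _ => Finset.sum_le_sum fun d _ => ?_
    have hin : ∑ a : Modes N, ∑ b : Modes N, conv a b c d * (h a c * h b c) ≤ Z := by
      have p1 : ∑ a : Modes N, ∑ b : Modes N, conv a b c d * h a c ^ 2 ≤ Z := by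
        refine le_trans (Finset.sum_le_sum fun a _ => ?_) (hsum c)
        rw [← Finset.sum_mul]
        refine mul_le_of_le_one_left (sq_nonneg _) ?_
        simp only [conv_comm_left a, conv_swap _ _ (c : ℤ)]
        simp only [conv_comm_right (c : ℤ) d _ a]
        exact sum_conv_le_one _ _ _
      have p2 : ∑ a : Modes N, ∑ b : Modes N, conv a b c d * h b c ^ 2 ≤ Z := by
        refine le_trans (le_of_eq ?_) p1
        rw [Finset.sum_comm]
        refine Finset.sum_congr rfl fun a _ => Finset.sum_congr rfl fun b _ => ?_
        rw [conv_comm_left]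
      have hpt : ∀ a b : Modes N, conv a b c d * (h a c * h b c) ≤
          1 / 2 * (conv a b c d * h a c ^ 2) + 1 / 2 * (conv a b c d * h b c ^ 2) := by
        intro a b
        have := mul_le_mul_of_nonneg_left (hprod a b c) (conv_nonneg a b c d)
        linarith
      refine (Finset.sum_le_sum fun a _ => Finset.sum_le_sum fun b _ => hpt a b).trans ?_
      simp only [Finset.sum_add_distrib, ← Finset.mul_sum]
      linarith
    have e : ∑ a : Modes N, ∑ b : Modes N, conv a b c d * (v c ^ 2 * W d ^ 2 * (h a c * h b c)) =
        v c ^ 2 * W d ^ 2 * ∑ a : Modes N, ∑ b : Modes N, conv a b c d * (h a c * h b c) := by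
      simp only [Finset.mul_sum]
      refine Finset.sum_congr rfl fun a _ => Finset.sum_congr rfl fun b _ => by ring
    rw [e]
    exact mul_le_mul_of_nonneg_left hin (by positivity)
  refine hcs.trans ((mul_le_mul b1 b2 ?_ (by positivity)).trans (le_of_eq (by ring)))
  exact Finset.sum_nonneg fun a _ => Finset.sum_nonneg fun b _ => Finset.sum_nonneg fun c _ =>
    Finset.sum_nonneg fun d _ => mul_nonneg (conv_nonneg _ _ _ _)
      (mul_nonneg (by positivity) (mul_nonneg (h0 _ _) (h0 _ _)))

/-! ### The energy in Fourier coordinates and its derivative -/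

theorem integral_exp_int (k : ℤ) :
    ∫ x in (0 : ℝ)..(2 * Real.pi), Complex.exp (Complex.I * (k : ℂ) * (x : ℂ)) =
      if k = 0 then 2 * (Real.pi : ℂ) else 0 := by
  split_ifs with h
  · simp [h]
  · have hc : Complex.I * (k : ℂ) ≠ 0 := mul_ne_zero Complex.I_ne_zero (by exact_mod_cast h)
    rw [integral_exp_mul_complex hc]
    have : Complex.exp (Complex.I * (k : ℂ) * ((2 * Real.pi : ℝ) : ℂ)) = 1 := by
      rw [Complex.exp_eq_one_iff]
      exact ⟨k, by push_cast; ring⟩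
    rw [this]
    simp

theorem conj_exp_int (k : ℤ) (x : ℝ) : starRingEnd ℂ (Complex.exp (Complex.I * (k : ℂ) * (x : ℂ))) =
    Complex.exp (Complex.I * ((-k : ℤ) : ℂ) * (x : ℂ)) := by
  rw [← Complex.exp_conj]
  congr 1
  simp

theorem integral_norm_sq_toFun (u : EN N) :
    ((∫ x in (0 : ℝ)..(2 * Real.pi), ‖u.toFun x‖ ^ 2 : ℝ) : ℂ) =
      2 * Real.pi * ∑ n, u n * starRingEnd ℂ (u n) := by
  rw [← intervalIntegral.integral_ofReal]
  have h : ∀ x : ℝ, ((‖u.toFun x‖ ^ 2 : ℝ) : ℂ) = ∑ a : Modes N, ∑ c : Modes N,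
      u a * starRingEnd ℂ (u c) *
        Complex.exp (Complex.I * (((a : ℤ) - (c : ℤ) : ℤ) : ℂ) * (x : ℂ)) := by
    intro x
    push_cast
    rw [← Complex.mul_conj', EN.toFun, map_sum, Finset.sum_mul_sum]
    refine Finset.sum_congr rfl fun a _ => Finset.sum_congr rfl fun c _ => ?_
    rw [map_mul, conj_exp_int, mul_mul_mul_comm, ← Complex.exp_add]
    congr 2
    push_cast
    ring
  simp_rw [h]
  rw [intervalIntegral.integral_finsetSum fun a _ =>
    (Continuous.intervalIntegrable (by fun_prop) _ _), Finset.mul_sum]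
  refine Finset.sum_congr rfl fun a _ => ?_
  rw [intervalIntegral.integral_finsetSum fun c _ =>
    (Continuous.intervalIntegrable (by fun_prop) _ _)]
  simp_rw [intervalIntegral.integral_const_mul, integral_exp_int]
  rw [Finset.sum_eq_single a]
  · simp
    ring
  · intro c _ hc
    rw [if_neg fun h => hc (Subtype.ext (by omega)), mul_zero]
  · simp

theorem integral_norm_pow_four_toFun (u : EN N) :
    ((∫ x in (0 : ℝ)..(2 * Real.pi), ‖u.toFun x‖ ^ 4 : ℝ) : ℂ) =
      2 * Real.pi * ∑ a : Modes N, ∑ b : Modes N, ∑ c : Modes N, ∑ d : Modes N,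
        (conv a b c d : ℂ) * (u a * u b * starRingEnd ℂ (u c) * starRingEnd ℂ (u d)) := by
  rw [← intervalIntegral.integral_ofReal]
  have h : ∀ x : ℝ, ((‖u.toFun x‖ ^ 4 : ℝ) : ℂ) =
      ∑ p : (Modes N × Modes N) × (Modes N × Modes N),
      (u p.1.1 * u p.1.2 * starRingEnd ℂ (u p.2.1) * starRingEnd ℂ (u p.2.2)) *
        Complex.exp (Complex.I *
          (((p.1.1 : ℤ) + (p.1.2 : ℤ) - (p.2.1 : ℤ) - (p.2.2 : ℤ) : ℤ) : ℂ) * (x : ℂ)) := by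
    intro x
    have e : ((‖u.toFun x‖ ^ 4 : ℝ) : ℂ) =
        (u.toFun x * u.toFun x) * (starRingEnd ℂ (u.toFun x) * starRingEnd ℂ (u.toFun x)) := by
      push_cast
      rw [mul_mul_mul_comm, Complex.mul_conj']
      ring
    rw [e, EN.toFun, map_sum, Finset.sum_mul_sum, Finset.sum_mul_sum, ← Fintype.sum_prod_type',
      ← Fintype.sum_prod_type', Finset.sum_mul_sum, ← Fintype.sum_prod_type']
    refine Finset.sum_congr rfl fun p _ => ?_
    rw [map_mul, map_mul, conj_exp_int, conj_exp_int]
    have hexp : Complex.exp (Complex.I *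
          (((p.1.1 : ℤ) + (p.1.2 : ℤ) - (p.2.1 : ℤ) - (p.2.2 : ℤ) : ℤ) : ℂ) * (x : ℂ)) =
        Complex.exp (Complex.I * ((p.1.1 : ℤ) : ℂ) * (x : ℂ)) *
        Complex.exp (Complex.I * ((p.1.2 : ℤ) : ℂ) * (x : ℂ)) *
        Complex.exp (Complex.I * ((-(p.2.1 : ℤ) : ℤ) : ℂ) * (x : ℂ)) *
        Complex.exp (Complex.I * ((-(p.2.2 : ℤ) : ℤ) : ℂ) * (x : ℂ)) := by
      rw [← Complex.exp_add, ← Complex.exp_add, ← Complex.exp_add]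
      congr 1
      push_cast
      ring
    rw [hexp]
    ring
  simp_rw [h]
  rw [intervalIntegral.integral_finsetSum fun a _ =>
    (Continuous.intervalIntegrable (by fun_prop) _ _)]
  simp_rw [intervalIntegral.integral_const_mul, integral_exp_int]
  rw [Fintype.sum_prod_type]
  simp only [Fintype.sum_prod_type, Finset.mul_sum]
  refine Finset.sum_congr rfl fun a _ => Finset.sum_congr rfl fun b _ =>
    Finset.sum_congr rfl fun c _ => Finset.sum_congr rfl fun d _ => ?_
  unfold conv
  by_cases hs : (a : ℤ) + b = c + d
  · rw [if_pos hs, if_pos (by omega)]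
    push_cast
    ring
  · rw [if_neg hs, if_neg (by omega)]
    push_cast
    ring

/-- The energy, as a polynomial in the Fourier coefficients. -/
def energyPoly (σ α : ℝ) (u : EN N) : ℂ :=
  Real.pi * (2 * ∑ n : Modes N, (disp α n : ℂ) * (u n * starRingEnd ℂ (u n)) +
    σ * ∑ a : Modes N, ∑ b : Modes N, ∑ c : Modes N, ∑ d : Modes N,
      (conv a b c d : ℂ) * (u a * u b * starRingEnd ℂ (u c) * starRingEnd ℂ (u d)))

theorem ofReal_energy (σ α : ℝ) (u : EN N) : (energy σ α u : ℂ) = energyPoly σ α u := by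
  unfold energy energyPoly
  rw [Complex.ofReal_add, Complex.ofReal_mul, integral_norm_pow_four_toFun,
    integral_norm_sq_toFun, mul_add]
  congr 1
  · have : ∀ n : Modes N, fracDeriv α u n * starRingEnd ℂ (fracDeriv α u n) =
        (disp α n : ℂ) * (u n * starRingEnd ℂ (u n)) := by
      intro n
      have e : disp α n = |((n : ℤ) : ℝ)| ^ α * |((n : ℤ) : ℝ)| ^ α := by
        rw [disp, mul_comm, Real.rpow_mul (abs_nonneg _), Real.rpow_two, sq]
      unfold fracDeriv
      rw [map_mul, Complex.conj_ofReal, e]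
      push_cast
      ring
    simp_rw [this]
    ring
  · push_cast
    ring

/-- The derivative of `energyPoly` at `u` in the direction `F`. -/
def energyPolyDeriv (σ α : ℝ) (u F : EN N) : ℂ :=
  Real.pi * (2 * ∑ n : Modes N, (disp α n : ℂ) *
      (F n * starRingEnd ℂ (u n) + u n * starRingEnd ℂ (F n)) +
    σ * ∑ a : Modes N, ∑ b : Modes N, ∑ c : Modes N, ∑ d : Modes N,
      (conv a b c d : ℂ) * (((F a * u b + u a * F b) * starRingEnd ℂ (u c) +
        u a * u b * starRingEnd ℂ (F c)) * starRingEnd ℂ (u d) +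
          u a * u b * starRingEnd ℂ (u c) * starRingEnd ℂ (F d)))

theorem hasDerivAt_energyPoly (σ α : ℝ) {γ : ℝ → EN N} {F : EN N} {t : ℝ}
    (h : HasDerivAt γ F t) :
    HasDerivAt (fun s => energyPoly σ α (γ s)) (energyPolyDeriv σ α (γ t) F) t := by
  have h1 : ∀ n, HasDerivAt (fun s => γ s n) (F n) t := hasDerivAt_pi.1 h
  have h2 : ∀ n, HasDerivAt (fun s => starRingEnd ℂ (γ s n)) (starRingEnd ℂ (F n)) t :=
    fun n => (h1 n).star
  unfold energyPoly energyPolyDeriv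
  refine HasDerivAt.const_mul _ (HasDerivAt.add (HasDerivAt.const_mul _ ?_)
    (HasDerivAt.const_mul _ ?_))
  · exact HasDerivAt.fun_sum fun n _ => ((h1 n).mul (h2 n)).const_mul _
  · exact HasDerivAt.fun_sum fun a _ => HasDerivAt.fun_sum fun b _ => HasDerivAt.fun_sum fun c _ =>
      HasDerivAt.fun_sum fun d _ => ((((h1 a).mul (h1 b)).mul (h2 c)).mul (h2 d)).const_mul _

/-- Only the initial velocity of the flow enters, so the derivative is an explicit polynomial in the
Fourier coefficients and their conjugates. -/
theorem hasDerivAt_energyAlongFlow (σ α : ℝ) (N : ℕ) (u : L2T) :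
    HasDerivAt (energyAlongFlow σ α N u)
      (energyPolyDeriv σ α (proj N u) (birkhoffField σ α (proj N u))).re 0 := by
  obtain ⟨h0, hd⟩ := isBirkhoffFlow_birkhoffFlow σ α N (proj N u)
  have h := hasDerivAt_energyPoly σ α (hd 0)
  rw [h0] at h
  have hre := Complex.reCLM.hasFDerivAt.comp_hasDerivAt 0 h
  refine hre.congr_of_eventuallyEq (Filter.Eventually.of_forall fun t => ?_)
  simp only [Function.comp, Complex.reCLM_apply, energyAlongFlow]
  rw [← ofReal_energy, Complex.ofReal_re]

theorem energyDerivative_eq (σ α : ℝ) (N : ℕ) (u : L2T) :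
    energyDerivative σ α N u =
      (energyPolyDeriv σ α (proj N u) (birkhoffField σ α (proj N u))).re :=
  (hasDerivAt_energyAlongFlow σ α N u).deriv

theorem continuous_proj (N : ℕ) : Continuous (proj N) := by
  refine continuous_pi fun n => ?_
  have : ∀ u : L2T, proj N u n = inner ℂ (fourierLp (T := 2 * Real.pi) 2 (n : ℤ)) u := by
    intro u
    rw [proj, ← fourierBasis_repr, HilbertBasis.repr_apply_apply, coe_fourierBasis]
  simp_rw [this]
  fun_prop

theorem continuous_energyDerivative (σ α : ℝ) (N : ℕ) : Continuous (energyDerivative σ α N) := by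
  have h : energyDerivative σ α N = fun u =>
      (energyPolyDeriv σ α (proj N u) (birkhoffField σ α (proj N u))).re :=
    funext fun u => energyDerivative_eq σ α N u
  have hF : Continuous (birkhoffField σ α : EN N → EN N) :=
      (contDiff_birkhoffField σ α N).continuous
  have hc : Continuous fun v : EN N => (energyPolyDeriv σ α v (birkhoffField σ α v)).re := by
    have hc1 : ∀ n, Continuous fun v : EN N => starRingEnd ℂ (v n) := fun n =>
      Complex.continuous_conj.comp (continuous_apply n)
    have hF1 : ∀ n, Continuous fun v : EN N => birkhoffField σ α v n := fun n =>
      (continuous_apply n).comp hF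
    have hF2 : ∀ n, Continuous fun v : EN N => starRingEnd ℂ (birkhoffField σ α v n) := fun n =>
      Complex.continuous_conj.comp (hF1 n)
    refine Complex.continuous_re.comp ?_
    unfold energyPolyDeriv
    fun_prop
  rw [h]
  exact hc.comp (continuous_proj N)

/-! ### Bounds for the derivative of the energy -/

/-- Along the Birkhoff flow the kinetic energy changes by a quartic form with bounded
coefficients. -/
theorem norm_kinetic_deriv_le {σ : ℝ} (hσ : |σ| = 1) (α : ℝ) (u : EN N) :
    ‖∑ n : Modes N, (disp α n : ℂ) * (birkhoffField σ α u n * starRingEnd ℂ (u n) +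
      u n * starRingEnd ℂ (birkhoffField σ α u n))‖ ≤ 1 / 2 * quarticSum fun n => ‖u n‖ := by
  set U : Modes N × Modes N → Modes N × Modes N → ℂ := fun p q =>
    u p.1 * u p.2 * starRingEnd ℂ (u q.1) * starRingEnd ℂ (u q.2) with hU
  set K : Modes N × Modes N → Modes N × Modes N → ℂ := fun p q =>
    (kernel σ α p.1 p.2 q.1 q.2 : ℂ) with hK
  set D : Modes N → ℂ := fun n => (disp α n : ℂ) with hD
  have hKsw : ∀ p q, K q p = -K p q := fun p q => by
    simp only [hK, kernel_swap σ α (p.1 : ℤ) p.2 q.1 q.2, Complex.ofReal_neg]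
  have hUc : ∀ p q, starRingEnd ℂ (U p q) = U q p := fun p q => by
    simp only [hU, map_mul, Complex.conj_conj]
    ring
  have hKc : ∀ p q, starRingEnd ℂ (K p q) = K p q := fun p q => Complex.conj_ofReal _
  have hker : ∀ a b c d : ℤ, kernel σ α a b c d = kernel σ α a b d c := fun a b c d => by
    unfold kernel
    rw [add_comm c d, add_comm (disp α c), sub_right_comm]
  have hker' : ∀ a b c d : ℤ, kernel σ α a b c d = kernel σ α b a c d := fun a b c d => by
    unfold kernel
    rw [add_comm a b, add_comm (disp α a)]
  have hKq : ∀ p q, K p q.swap = K p q := fun p q => by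
    simp only [hK, Prod.fst_swap, Prod.snd_swap]
    rw [hker]
  have hKp : ∀ p q, K p.swap q = K p q := fun p q => by
    simp only [hK, Prod.fst_swap, Prod.snd_swap]
    rw [hker']
  have hUq : ∀ p q, U p q.swap = U p q := fun p q => by
    simp only [hU, Prod.fst_swap, Prod.snd_swap]
    ring
  have hUp : ∀ p q, U p.swap q = U p q := fun p q => by
    simp only [hU, Prod.fst_swap, Prod.snd_swap]
    ring
  set T : ℂ := ∑ n : Modes N, D n * (birkhoffField σ α u n * starRingEnd ℂ (u n)) with hT
  have hT1 : T = ∑ p, ∑ q : Modes N × Modes N, D q.2 * (K p q * U p q) := by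
    rw [hT]
    simp only [birkhoffField, Finset.mul_sum, Finset.sum_mul, Fintype.sum_prod_type, hU, hK]
    rw [Finset.sum_comm]
    refine Finset.sum_congr rfl fun a _ => ?_
    rw [Finset.sum_comm]
    refine Finset.sum_congr rfl fun b _ => ?_
    rw [Finset.sum_comm]
    refine Finset.sum_congr rfl fun c _ => Finset.sum_congr rfl fun n _ => by ring
  have hT2 : T = ∑ p, ∑ q : Modes N × Modes N, D q.1 * (K p q * U p q) := by
    rw [hT1]
    refine Finset.sum_congr rfl fun p _ => ?_
    rw [← Equiv.sum_comp (Equiv.prodComm (Modes N) (Modes N))]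
    refine Finset.sum_congr rfl fun q _ => ?_
    simp only [Equiv.prodComm_apply, Prod.snd_swap, hKq, hUq]
  have hc1 : starRingEnd ℂ T = ∑ p, ∑ q : Modes N × Modes N, -(D p.2 * (K p q * U p q)) := by
    rw [hT1, Finset.sum_comm, map_sum]
    refine Finset.sum_congr rfl fun q _ => ?_
    rw [map_sum]
    refine Finset.sum_congr rfl fun p _ => ?_
    rw [map_mul, map_mul, hUc, hKc, hKsw q p, hD, Complex.conj_ofReal]
    ring
  have hc2 : starRingEnd ℂ T = ∑ p, ∑ q : Modes N × Modes N, -(D p.1 * (K p q * U p q)) := by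
    rw [hc1, ← Equiv.sum_comp (Equiv.prodComm (Modes N) (Modes N))]
    refine Finset.sum_congr rfl fun p _ => Finset.sum_congr rfl fun q _ => ?_
    simp only [Equiv.prodComm_apply, Prod.snd_swap, hKp, hUp]
  have hsum : ∑ n : Modes N, (disp α n : ℂ) * (birkhoffField σ α u n * starRingEnd ℂ (u n) +
      u n * starRingEnd ℂ (birkhoffField σ α u n)) = T + starRingEnd ℂ T := by
    rw [hT, map_sum, ← Finset.sum_add_distrib]
    refine Finset.sum_congr rfl fun n _ => ?_
    rw [map_mul, map_mul, Complex.conj_conj, hD, Complex.conj_ofReal]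
    ring
  -- Each of `T` and its conjugate is written in both of its forms and averaged, so that the four
  -- dispersion values combine into the resonance function.
  have hmain : T + starRingEnd ℂ T = ∑ p, ∑ q : Modes N × Modes N,
      1 / 2 * ((D q.1 + D q.2 - D p.1 - D p.2) * K p q * U p q) := by
    have : T + starRingEnd ℂ T =
        1 / 2 * (T + T + starRingEnd ℂ T + starRingEnd ℂ T) := by ring
    rw [this]
    nth_rw 1 [hT1]
    rw [hT2, ← hT2]
    nth_rw 1 [hc1]
    rw [hc2, hT2]
    simp only [← Finset.sum_add_distrib, Finset.mul_sum]
    refine Finset.sum_congr rfl fun p _ => Finset.sum_congr rfl fun q _ => by ring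
  -- The resonance function cancels the denominator of the kernel: `σ` remains on nonresonant
  -- quadruples, `0` elsewhere.
  have hcoef : ∀ p q, ‖(D q.1 + D q.2 - D p.1 - D p.2) * K p q‖ ≤ conv p.1 p.2 q.1 q.2 := by
    intro p q
    simp only [hD, hK]
    rw [← Complex.ofReal_add, ← Complex.ofReal_sub, ← Complex.ofReal_sub, ← Complex.ofReal_mul,
      Complex.norm_real, Real.norm_eq_abs]
    unfold kernel conv
    split_ifs with h1 h2 h3
    · have hne : disp α p.1 + disp α p.2 - disp α q.1 - disp α q.2 ≠ 0 := fun h =>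
        h1.2 (by linarith)
      have : (disp α q.1 + disp α q.2 - disp α p.1 - disp α p.2) *
          (-σ / (disp α p.1 + disp α p.2 - disp α q.1 - disp α q.2)) = σ := by
        field_simp
        ring
      rw [this, hσ]
    · exact absurd h1.1 h2
    · simp
    · simp
  rw [hsum, hmain, quarticSum]
  simp only [Fintype.sum_prod_type, Finset.mul_sum]
  refine norm_sum_le_of_le _ fun a _ => norm_sum_le_of_le _ fun b _ =>
    norm_sum_le_of_le _ fun c _ => norm_sum_le_of_le _ fun d _ => ?_
  rw [norm_mul, norm_mul]
  have e1 : ‖(1 / 2 : ℂ)‖ = 1 / 2 := by norm_num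
  have e2 : ‖U (a, b) (c, d)‖ = ‖u a‖ * ‖u b‖ * ‖u c‖ * ‖u d‖ := by
    simp only [hU, norm_mul, RCLike.norm_conj]
  rw [e1, e2]
  exact mul_le_mul_of_nonneg_left
    (mul_le_mul_of_nonneg_right (hcoef (a, b) (c, d)) (by positivity)) (by norm_num)

/-- The symmetries of `a + b = c + d` make the four positions of `F` equivalent once absolute values
are taken. -/
theorem norm_quartic_deriv_le (u F : EN N) :
    ‖∑ a : Modes N, ∑ b : Modes N, ∑ c : Modes N, ∑ d : Modes N,
      (conv a b c d : ℂ) * (((F a * u b + u a * F b) * starRingEnd ℂ (u c) +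
        u a * u b * starRingEnd ℂ (F c)) * starRingEnd ℂ (u d) +
          u a * u b * starRingEnd ℂ (u c) * starRingEnd ℂ (F d))‖ ≤
      4 * ∑ d, ‖F d‖ * cubicSum (fun n => ‖u n‖) d := by
  set f : Modes N → ℝ := fun n => ‖u n‖ with hf
  set g : Modes N → ℝ := fun n => ‖F n‖ with hg
  have b4 : ∑ a : Modes N, ∑ b : Modes N, ∑ c : Modes N, ∑ d : Modes N,
      conv a b c d * (f a * f b * f c * g d) = ∑ d, g d * cubicSum f d := by
    have : ∀ d, g d * cubicSum f d = ∑ a : Modes N, ∑ b : Modes N, ∑ c : Modes N,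
        conv a b c d * (f a * f b * f c * g d) := by
      intro d
      simp only [cubicSum, Finset.mul_sum]
      refine Finset.sum_congr rfl fun a _ => Finset.sum_congr rfl fun b _ =>
        Finset.sum_congr rfl fun c _ => by ring
    simp_rw [this]
    symm
    exact Finset.sum_comm.trans (Finset.sum_congr rfl fun a _ =>
      Finset.sum_comm.trans (Finset.sum_congr rfl fun b _ => Finset.sum_comm))
  have b3 : ∑ a : Modes N, ∑ b : Modes N, ∑ c : Modes N, ∑ d : Modes N,
      conv a b c d * (f a * f b * g c * f d) = ∑ d, g d * cubicSum f d := by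
    rw [← b4]
    refine Finset.sum_congr rfl fun a _ => Finset.sum_congr rfl fun b _ => ?_
    rw [Finset.sum_comm]
    refine Finset.sum_congr rfl fun c _ => Finset.sum_congr rfl fun d _ => ?_
    rw [conv_comm_right]
    ring
  have b2 : ∑ a : Modes N, ∑ b : Modes N, ∑ c : Modes N, ∑ d : Modes N,
      conv a b c d * (f a * g b * f c * f d) = ∑ d, g d * cubicSum f d := by
    rw [← b4, sum_sum_comm]
    refine Finset.sum_congr rfl fun a _ => Finset.sum_congr rfl fun b _ =>
      Finset.sum_congr rfl fun c _ => Finset.sum_congr rfl fun d _ => ?_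
    rw [conv_swap]
    ring
  have b1 : ∑ a : Modes N, ∑ b : Modes N, ∑ c : Modes N, ∑ d : Modes N,
      conv a b c d * (g a * f b * f c * f d) = ∑ d, g d * cubicSum f d := by
    rw [← b2, Finset.sum_comm]
    refine Finset.sum_congr rfl fun a _ => Finset.sum_congr rfl fun b _ =>
      Finset.sum_congr rfl fun c _ => Finset.sum_congr rfl fun d _ => ?_
    rw [conv_comm_left]
    ring
  have hle : ∀ a b c d : Modes N,
      ‖(conv a b c d : ℂ) * (((F a * u b + u a * F b) * starRingEnd ℂ (u c) +
        u a * u b * starRingEnd ℂ (F c)) * starRingEnd ℂ (u d) +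
          u a * u b * starRingEnd ℂ (u c) * starRingEnd ℂ (F d))‖ ≤
      conv a b c d * (g a * f b * f c * f d) + conv a b c d * (f a * g b * f c * f d) +
      conv a b c d * (f a * f b * g c * f d) + conv a b c d * (f a * f b * f c * g d) := by
    intro a b c d
    rw [norm_mul, Complex.norm_real, Real.norm_of_nonneg (conv_nonneg _ _ _ _), ← mul_add,
      ← mul_add, ← mul_add]
    refine mul_le_mul_of_nonneg_left ?_ (conv_nonneg _ _ _ _)
    have e : ((F a * u b + u a * F b) * starRingEnd ℂ (u c) +
        u a * u b * starRingEnd ℂ (F c)) * starRingEnd ℂ (u d) +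
          u a * u b * starRingEnd ℂ (u c) * starRingEnd ℂ (F d) =
        F a * u b * starRingEnd ℂ (u c) * starRingEnd ℂ (u d) +
        u a * F b * starRingEnd ℂ (u c) * starRingEnd ℂ (u d) +
        u a * u b * starRingEnd ℂ (F c) * starRingEnd ℂ (u d) +
        u a * u b * starRingEnd ℂ (u c) * starRingEnd ℂ (F d) := by ring
    rw [e]
    refine norm_add₄_le.trans (le_of_eq ?_)
    simp only [norm_mul, RCLike.norm_conj, hf, hg]
  refine (norm_sum_le_of_le _ fun a _ => norm_sum_le_of_le _ fun b _ =>
    norm_sum_le_of_le _ fun c _ => norm_sum_le_of_le _ fun d _ => hle a b c d).trans ?_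
  simp only [Finset.sum_add_distrib]
  rw [b1, b2, b3, b4]
  linarith

/-- The kernel bound puts all derivative losses on the three inputs, so the Hilbert-type inequality
applies to `v = weight^ρ |u|` and `W` enters only through its `ℓ²` norm. -/
theorem sum_norm_field_mul_le {σ α : ℝ} (hσ : |σ| = 1) (h0 : 9 / 10 < α) (h1 : α ≤ 1)
    (u : EN N) {W : Modes N → ℝ} (hW : ∀ n, 0 ≤ W n) :
    (∑ d, ‖birkhoffField σ α u d‖ * W d) ^ 2 ≤ 9 * (sumInvSq ^ 2 *
      (∑ n : Modes N, weight α n ^ (2 * ((1 - α) / α)) * ‖u n‖ ^ 2) ^ 3 * ∑ n, W n ^ 2) := by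
  set ρ := (1 - α) / α with hρ
  set v : Modes N → ℝ := fun n => weight α n ^ ρ * ‖u n‖ with hv
  have hv2 : ∀ n, v n ^ 2 = weight α n ^ (2 * ρ) * ‖u n‖ ^ 2 := by
    intro n
    rw [hv, mul_pow, mul_comm 2 ρ, Real.rpow_mul (weight_pos _ _).le]
    norm_cast
  have key : ∑ d, ‖birkhoffField σ α u d‖ * W d ≤
      3 * ∑ a : Modes N, ∑ b : Modes N, ∑ c : Modes N, ∑ d : Modes N,
        conv a b c d * (v a * v b * v c * W d *
      (|((a : ℤ) - (c : ℤ) : ℝ)|⁻¹ * |((b : ℤ) - (c : ℤ) : ℝ)|⁻¹)) := by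
    have hF : ∀ d, ‖birkhoffField σ α u d‖ * W d ≤
        ∑ a : Modes N, ∑ b : Modes N, ∑ c : Modes N, 3 * (conv a b c d * (v a * v b * v c * W d *
      (|((a : ℤ) - (c : ℤ) : ℝ)|⁻¹ * |((b : ℤ) - (c : ℤ) : ℝ)|⁻¹))) := by
      intro d
      have hb : ‖birkhoffField σ α u d‖ ≤ ∑ a : Modes N, ∑ b : Modes N, ∑ c : Modes N,
          |kernel σ α a b c d| * ‖u a‖ * ‖u b‖ * ‖u c‖ := by
        refine norm_sum_le_of_le _ fun a _ => norm_sum_le_of_le _ fun b _ =>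
          norm_sum_le_of_le _ fun c _ => le_of_eq ?_
        simp only [norm_mul, RCLike.norm_conj, Complex.norm_real, Real.norm_eq_abs]
      refine (mul_le_mul_of_nonneg_right hb (hW d)).trans ?_
      simp only [Finset.sum_mul]
      refine Finset.sum_le_sum fun a _ => Finset.sum_le_sum fun b _ =>
        Finset.sum_le_sum fun c _ => ?_
      have hk := abs_kernel_le hσ h0 h1 (a : ℤ) b c d
      have hn : 0 ≤ ‖u a‖ * ‖u b‖ * ‖u c‖ * W d := mul_nonneg (by positivity) (hW d)
      have := mul_le_mul_of_nonneg_right hk hn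
      refine le_trans (le_of_eq (by ring)) (this.trans (le_of_eq ?_))
      simp only [conv, hv]
      split_ifs <;> ring
    refine (Finset.sum_le_sum fun d _ => hF d).trans (le_of_eq ?_)
    simp only [Finset.mul_sum]
    exact Finset.sum_comm.trans (Finset.sum_congr rfl fun a _ =>
      Finset.sum_comm.trans (Finset.sum_congr rfl fun b _ => Finset.sum_comm))
  have hnn : 0 ≤ ∑ d, ‖birkhoffField σ α u d‖ * W d :=
    Finset.sum_nonneg fun d _ => mul_nonneg (norm_nonneg _) (hW d)
  refine (pow_le_pow_left₀ hnn key 2).trans ?_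
  rw [mul_pow]
  have := sum_conv_hilbert_le (v := v) (W := W)
  simp only [hv2] at this
  rw [show (3 : ℝ) ^ 2 = 9 by norm_num]
  exact mul_le_mul_of_nonneg_left this (by norm_num)

/-- The exponent `r` for which the norm `(∑ (1 + |n|^{2α})^r |u(n)|²)^{1/2}`, which is that of
the Sobolev space `H^{7/20}`, is used. -/
def sobolevExp (α : ℝ) : ℝ := 7 / (20 * α)

/-- `∑ (1 + |n|^{2α})^{-3r/2}`. -/
def weightSum (α : ℝ) : ℝ := ∑' n : ℤ, weight α n ^ (-(3 / 2 * sobolevExp α))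

theorem sobolevExp_pos {α : ℝ} (h0 : 9 / 10 < α) : 0 < sobolevExp α := by
  unfold sobolevExp
  positivity

theorem sobolevExp_le {α : ℝ} (h0 : 9 / 10 < α) : sobolevExp α ≤ 7 / 18 := by
  unfold sobolevExp
  rw [div_le_div_iff₀ (by linarith) (by norm_num)]
  linarith

theorem summable_weight {α : ℝ} (h0 : 9 / 10 < α) :
    Summable fun n : ℤ => weight α n ^ (-(3 / 2 * sobolevExp α)) := by
  -- The terms decay like `|n|^{-21/20}`, because `2α · (3/2) · 7/(20α) = 21/20`.
  have h := Real.summable_abs_int_rpow (b := 21 / 20) (by norm_num)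
  refine Summable.of_norm_bounded_eventually h ?_
  filter_upwards [(Set.finite_singleton (0 : ℤ)).compl_mem_cofinite] with n hn
  have hn0 : (0 : ℝ) < |(n : ℝ)| := abs_pos.2 (by exact_mod_cast hn)
  have hp : 0 < disp α n := Real.rpow_pos_of_pos hn0 _
  have hr := sobolevExp_pos h0
  rw [Real.norm_of_nonneg (Real.rpow_nonneg (weight_pos _ _).le _)]
  have e : |(n : ℝ)| ^ (-(21 / 20) : ℝ) = disp α n ^ (-(3 / 2 * sobolevExp α)) := by
    have hα : 0 < α := by linarith
    rw [disp, ← Real.rpow_mul (abs_nonneg _), sobolevExp]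
    congr 1
    field_simp
    norm_num
  rw [e]
  exact Real.rpow_le_rpow_of_nonpos hp (by unfold weight; linarith) (by linarith)

theorem weightSum_nonneg (α : ℝ) : 0 ≤ weightSum α :=
  tsum_nonneg fun n => Real.rpow_nonneg (weight_pos α n).le _

theorem sum_weight_le {α : ℝ} (h0 : 9 / 10 < α) (s : Finset ℤ) :
    ∑ n ∈ s, weight α n ^ (-(3 / 2 * sobolevExp α)) ≤ weightSum α :=
  (summable_weight h0).sum_le_tsum s fun n _ => Real.rpow_nonneg (weight_pos α n).le _

theorem sum_modes_weight_le {α : ℝ} (h0 : 9 / 10 < α) :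
    ∑ n : Modes N, (weight α n ^ (-(sobolevExp α / 2))) ^ 3 ≤ weightSum α := by
  refine le_trans (le_of_eq ?_) (sum_weight_le h0 (Finset.Icc (-(N : ℤ)) N))
  rw [← Finset.sum_coe_sort (Finset.Icc (-(N : ℤ)) N)
    fun n => weight α n ^ (-(3 / 2 * sobolevExp α))]
  refine Finset.sum_congr rfl fun n _ => ?_
  rw [← Real.rpow_natCast, ← Real.rpow_mul (weight_pos _ _).le]
  congr 1
  push_cast
  ring

/-- The energy derivative in terms of two Sobolev norms. -/
theorem abs_energyPolyDeriv_le {σ α : ℝ} (hσ : |σ| = 1) (h0 : 9 / 10 < α) (h1 : α ≤ 1)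
    (u : EN N) {X Y : ℝ} (hX : ∑ n : Modes N, weight α n ^ sobolevExp α * ‖u n‖ ^ 2 ≤ X)
    (hY : ∑ n : Modes N, weight α n ^ (2 * ((1 - α) / α)) * ‖u n‖ ^ 2 ≤ Y) :
    |(energyPolyDeriv σ α u (birkhoffField σ α u)).re| ≤
      Real.pi * (weightSum α * X ^ 2 +
        4 * (3 * sumInvSq * weightSum α * Real.sqrt (Y ^ 3 * X ^ 3))) := by
  set S := weightSum α
  have hS : 0 ≤ S := weightSum_nonneg α
  set s : Modes N → ℝ := fun n => weight α n ^ (-(sobolevExp α / 2)) with hs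
  set A : Modes N → ℝ := fun n => weight α n ^ sobolevExp α * ‖u n‖ ^ 2 with hA
  have hs0 : ∀ n, 0 ≤ s n := fun n => Real.rpow_nonneg (weight_pos _ _).le _
  have hs1 : ∀ n, s n ≤ 1 := fun n =>
    Real.rpow_le_one_of_one_le_of_nonpos (one_le_weight _ _)
      (by have := sobolevExp_pos h0; linarith)
  have hA0 : ∀ n, 0 ≤ A n := fun n =>
    mul_nonneg (Real.rpow_nonneg (weight_pos _ _).le _) (sq_nonneg _)
  have hAs : ∀ n, ‖u n‖ ^ 2 = A n * s n ^ 2 := by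
    intro n
    simp only [hA, hs]
    rw [← Real.rpow_natCast (weight α n ^ _) 2, ← Real.rpow_mul (weight_pos _ _).le, mul_right_comm,
      ← Real.rpow_add (weight_pos _ _)]
    have : sobolevExp α + -(sobolevExp α / 2) * ((2 : ℕ) : ℝ) = 0 := by
      push_cast
      ring
    rw [this, Real.rpow_zero, one_mul]
  have hAX : 0 ≤ ∑ n, A n := Finset.sum_nonneg fun n _ => hA0 n
  have hX0 : 0 ≤ X := hAX.trans hX
  have hBY : 0 ≤ ∑ n : Modes N, weight α n ^ (2 * ((1 - α) / α)) * ‖u n‖ ^ 2 :=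
    Finset.sum_nonneg fun n _ => mul_nonneg (Real.rpow_nonneg (weight_pos _ _).le _) (sq_nonneg _)
  have hY0 : 0 ≤ Y := hBY.trans hY
  have hQ : quarticSum (fun n => ‖u n‖) ≤ S * X ^ 2 :=
    (quarticSum_le hs0 hs1 hA0 hAs).trans (mul_le_mul (sum_modes_weight_le h0)
      (pow_le_pow_left₀ hAX hX 2) (sq_nonneg _) hS)
  have hW0 : ∀ d, 0 ≤ cubicSum (fun n => ‖u n‖) d := fun d => Finset.sum_nonneg fun a _ =>
    Finset.sum_nonneg fun b _ => Finset.sum_nonneg fun c _ =>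
      mul_nonneg (conv_nonneg _ _ _ _) (by positivity)
  have hs3 : 0 ≤ ∑ n, s n ^ 3 := Finset.sum_nonneg fun n _ => pow_nonneg (hs0 n) 3
  have hW : ∑ d, cubicSum (fun n => ‖u n‖) d ^ 2 ≤ S ^ 2 * X ^ 3 :=
    (sum_sq_cubicSum_le hs0 hA0 hAs).trans (mul_le_mul
      (pow_le_pow_left₀ hs3 (sum_modes_weight_le h0) 2)
      (pow_le_pow_left₀ hAX hX 3) (pow_nonneg hAX 3) (sq_nonneg _))
  -- The field is paired with the cubic sum: the former contributes `Y^{3/2}`, the latter `X^{3/2}`.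
  have h6 : ∑ d, ‖birkhoffField σ α u d‖ * cubicSum (fun n => ‖u n‖) d ≤
      3 * sumInvSq * S * Real.sqrt (Y ^ 3 * X ^ 3) := by
    have hZ := sumInvSq_nonneg
    refine abs_le_of_sq_le_sq' ?_ (by positivity) |>.2
    refine (sum_norm_field_mul_le hσ h0 h1 u hW0).trans ?_
    rw [mul_pow, Real.sq_sqrt (by positivity)]
    calc _ ≤ 9 * (sumInvSq ^ 2 * Y ^ 3 * (S ^ 2 * X ^ 3)) := by
          refine mul_le_mul_of_nonneg_left ?_ (by norm_num)
          refine mul_le_mul ?_ hW (Finset.sum_nonneg fun d _ => sq_nonneg _) (by positivity)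
          exact mul_le_mul_of_nonneg_left (pow_le_pow_left₀ hBY hY 3) (sq_nonneg _)
      _ = _ := by ring
  refine (Complex.abs_re_le_norm _).trans ?_
  unfold energyPolyDeriv
  rw [norm_mul, Complex.norm_real, Real.norm_of_nonneg Real.pi_pos.le]
  refine mul_le_mul_of_nonneg_left ?_ Real.pi_pos.le
  refine (norm_add_le _ _).trans ?_
  rw [norm_mul, norm_mul, Complex.norm_real, Real.norm_eq_abs, hσ, one_mul]
  have k1 := norm_kinetic_deriv_le hσ α u
  have k2 := norm_quartic_deriv_le u (birkhoffField σ α u)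
  have k3 : ‖(2 : ℂ)‖ = 2 := by norm_num
  rw [k3]
  linarith

/-- The weights `min 1 (λ (1 + |n|^{2α})^{r - 1})`, whose sum is `O(λ)`. -/
def cutoff (α lam : ℝ) (n : ℤ) : ℝ := min 1 (lam * weight α n ^ (sobolevExp α - 1))

theorem cutoff_nonneg {α lam : ℝ} (hl : 1 ≤ lam) (n : ℤ) : 0 ≤ cutoff α lam n :=
  le_min zero_le_one (mul_nonneg (by linarith) (Real.rpow_nonneg (weight_pos α n).le _))

theorem sum_cutoff_le {α lam : ℝ} (h0 : 9 / 10 < α) (hl : 1 ≤ lam) (s : Finset ℤ) :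
    ∑ n ∈ s, cutoff α lam n ≤ weightSum α * lam := by
  have h : ∀ n, cutoff α lam n ≤ lam * weight α n ^ (-(3 / 2 * sobolevExp α)) := by
    intro n
    refine (min_le_right _ _).trans (mul_le_mul_of_nonneg_left ?_ (by linarith))
    -- The comparison `r - 1 ≤ -3r/2` amounts to `r ≤ 2/5`, and `r ≤ 7/18`.
    refine Real.rpow_le_rpow_of_exponent_le (one_le_weight α n) ?_
    have := sobolevExp_le h0
    linarith
  refine (Finset.sum_le_sum fun n _ => h n).trans ?_
  rw [← Finset.mul_sum, mul_comm]
  exact mul_le_mul_of_nonneg_right (sum_weight_le h0 s) (by linarith)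

/-- Pointwise interpolation between the `L²` norm and the cut-off Gaussian sum. Where the cutoff is
`1`, it is the usual comparison of `J` with `λ`; elsewhere the last term equals `λ^ρ J^r`, which
dominates `J^ρ` since `ρ ≤ r`. With a Gaussian sum of size `λ`, both terms scale as `λ^ρ`. -/
theorem weight_rpow_le {α lam ρ : ℝ} (h0 : 9 / 10 < α) (hl : 1 ≤ lam) (hρ0 : 0 ≤ ρ)
    (hρ : ρ ≤ sobolevExp α) (n : ℤ) :
    weight α n ^ ρ ≤ lam ^ ρ + lam ^ (ρ - 1) * (cutoff α lam n * weight α n) := by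
  have hl0 : 0 < lam := by linarith
  have hJ := one_le_weight α n
  have hJ0 := weight_pos α n
  set J := weight α n with hJdef
  have hlp : 0 < lam ^ ρ := Real.rpow_pos_of_pos hl0 _
  have hlp1 : 0 < lam ^ (ρ - 1) := Real.rpow_pos_of_pos hl0 _
  have hr := sobolevExp_le h0
  rcases min_choice 1 (lam * J ^ (sobolevExp α - 1)) with h | h
  · rw [cutoff, h, one_mul]
    rcases le_total J lam with hJl | hJl
    · have := Real.rpow_le_rpow hJ0.le hJl hρ0
      have := mul_pos hlp1 hJ0
      linarith
    · have e : J ^ ρ = J ^ (ρ - 1) * J := by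
        rw [← Real.rpow_add_one hJ0.ne']
        congr 1
        ring
      have := Real.rpow_le_rpow_of_nonpos hl0 hJl (show ρ - 1 ≤ 0 by linarith)
      have := mul_le_mul_of_nonneg_right this hJ0.le
      linarith
  · rw [cutoff, h]
    have e : lam ^ (ρ - 1) * (lam * J ^ (sobolevExp α - 1) * J) = lam ^ ρ * J ^ sobolevExp α := by
      have e1 : lam ^ ρ = lam ^ (ρ - 1) * lam := by
        rw [← Real.rpow_add_one hl0.ne']
        congr 1
        ring
      have e2 : J ^ sobolevExp α = J ^ (sobolevExp α - 1) * J := by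
        rw [← Real.rpow_add_one hJ0.ne']
        congr 1
        ring
      rw [e1, e2]
      ring
    rw [e]
    have e3 := Real.rpow_le_rpow_of_exponent_le hJ hρ
    have e4 : 1 ≤ lam ^ ρ := Real.one_le_rpow hl hρ0
    have e5 : 0 ≤ J ^ sobolevExp α := Real.rpow_nonneg hJ0.le _
    nlinarith

theorem sum_weight_rpow_le {α lam ρ R K : ℝ} (h0 : 9 / 10 < α) (hl : 1 ≤ lam) (hρ0 : 0 ≤ ρ)
    (hρ : ρ ≤ sobolevExp α) {f : Modes N → ℝ} (hR : ∑ n, f n ^ 2 ≤ R ^ 2)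
    (hK : ∑ n : Modes N, cutoff α lam n * (weight α n * f n ^ 2) ≤ K * lam) :
    ∑ n : Modes N, weight α n ^ ρ * f n ^ 2 ≤ (R ^ 2 + K) * lam ^ ρ := by
  have hl0 : 0 < lam := by linarith
  have hpt : ∀ n : Modes N, weight α n ^ ρ * f n ^ 2 ≤
      lam ^ ρ * f n ^ 2 + lam ^ (ρ - 1) * (cutoff α lam n * (weight α n * f n ^ 2)) := by
    intro n
    refine (mul_le_mul_of_nonneg_right (weight_rpow_le h0 hl hρ0 hρ n) (sq_nonneg _)).trans
      (le_of_eq (by ring))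
  refine (Finset.sum_le_sum fun n _ => hpt n).trans ?_
  rw [Finset.sum_add_distrib, ← Finset.mul_sum, ← Finset.mul_sum]
  have e : lam ^ ρ = lam ^ (ρ - 1) * lam := by
    rw [← Real.rpow_add_one hl0.ne']
    congr 1
    ring
  have b1 := mul_le_mul_of_nonneg_left hR (Real.rpow_pos_of_pos hl0 ρ).le
  have b2 := mul_le_mul_of_nonneg_left hK (Real.rpow_pos_of_pos hl0 (ρ - 1)).le
  calc _ ≤ lam ^ ρ * R ^ 2 + lam ^ (ρ - 1) * (K * lam) := add_le_add b1 b2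
    _ = lam ^ ρ * R ^ 2 + K * (lam ^ (ρ - 1) * lam) := by ring
    _ = _ := by
      rw [← e]
      ring

/-- The energy derivative is `O(λ^{1/ζ})` when the weighted sum of the Gaussians is `O(λ)`. -/
theorem abs_energyPolyDeriv_le_rpow {σ α lam R K : ℝ} (hσ : |σ| = 1) (h0 : 9 / 10 < α)
    (h1 : α ≤ 1) (hl : 1 ≤ lam) (hK0 : 0 ≤ K) {u : EN N} (hR : ∑ n, ‖u n‖ ^ 2 ≤ R ^ 2)
    (hK : ∑ n : Modes N, cutoff α lam n * (weight α n * ‖u n‖ ^ 2) ≤ K * lam) :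
    |(energyPolyDeriv σ α u (birkhoffField σ α u)).re| ≤
      Real.pi * (weightSum α * (R ^ 2 + K) ^ 2 +
        4 * (3 * sumInvSq * weightSum α * (R ^ 2 + K) ^ 3)) * lam ^ (1 / zeta α) := by
  have hα : 0 < α := by linarith
  have hl0 : 0 < lam := by linarith
  set r := sobolevExp α with hr
  set q := (1 - α) / α with hq
  have hq0 : 0 ≤ q := div_nonneg (by linarith) hα.le
  -- This allows the interpolation to be used for `Y` as well as for `X`.
  have hqr : 2 * q ≤ r := by
    rw [hq, hr, sobolevExp, ← mul_div_assoc, div_le_div_iff₀ hα (by linarith)]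
    nlinarith
  have hX := sum_weight_rpow_le h0 hl (sobolevExp_pos h0).le le_rfl hR hK
  have hY := sum_weight_rpow_le h0 hl (by linarith) hqr hR hK
  refine (abs_energyPolyDeriv_le hσ h0 h1 u hX hY).trans ?_
  set B := R ^ 2 + K
  have hB : 0 ≤ B := by positivity
  have hS := weightSum_nonneg α
  have hZ := sumInvSq_nonneg
  have c1 : (B * lam ^ r) ^ 2 ≤ B ^ 2 * lam ^ (1 / zeta α) := by
    rw [mul_pow, ← Real.rpow_natCast (lam ^ r), ← Real.rpow_mul hl0.le]
    refine mul_le_mul_of_nonneg_left (Real.rpow_le_rpow_of_exponent_le hl ?_) (sq_nonneg _)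
    have := quartic_exponent_le h0 h1
    rw [hr, sobolevExp]
    push_cast
    linarith
  have c2 : Real.sqrt ((B * lam ^ (2 * q)) ^ 3 * (B * lam ^ r) ^ 3) ≤
      B ^ 3 * lam ^ (1 / zeta α) := by
    have e : (B * lam ^ (2 * q)) ^ 3 * (B * lam ^ r) ^ 3 =
        (B ^ 3 * lam ^ (3 * q + 3 / 2 * r)) ^ 2 := by
      have e1 : lam ^ (3 * q + 3 / 2 * r) = (lam ^ (2 * q) * lam ^ r) ^ (3 / 2 : ℝ) := by
        rw [← Real.rpow_add hl0, ← Real.rpow_mul hl0.le]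
        congr 1
        ring
      have e2 : ((lam ^ (2 * q) * lam ^ r) ^ (3 / 2 : ℝ)) ^ 2 = (lam ^ (2 * q) * lam ^ r) ^ 3 := by
        rw [← Real.rpow_natCast, ← Real.rpow_mul (by positivity), ← Real.rpow_natCast _ 3]
        norm_num
      rw [e1, mul_pow (B ^ 3), e2]
      ring
    rw [e, Real.sqrt_sq (by positivity)]
    refine mul_le_mul_of_nonneg_left (Real.rpow_le_rpow_of_exponent_le hl ?_) (by positivity)
    exact sextic_exponent_le h0 h1
  have d1 := mul_le_mul_of_nonneg_left c1 hS
  have d2 := mul_le_mul_of_nonneg_left c2 (show 0 ≤ 3 * sumInvSq * weightSum α by positivity)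
  have : weightSum α * (B * lam ^ r) ^ 2 + 4 * (3 * sumInvSq * weightSum α *
      Real.sqrt ((B * lam ^ (2 * q)) ^ 3 * (B * lam ^ r) ^ 3)) ≤
      (weightSum α * B ^ 2 + 4 * (3 * sumInvSq * weightSum α * B ^ 3)) * lam ^ (1 / zeta α) := by
    linarith
  exact (mul_le_mul_of_nonneg_left this Real.pi_pos.le).trans (le_of_eq (by ring))

/-! ### Exponential moments of Gaussian variables -/

theorem lintegral_exp_sq_gaussianReal :
    ∫⁻ x, ENNReal.ofReal (Real.exp (x ^ 2 / 2)) ∂(gaussianReal 0 (1 / 2)) =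
      ENNReal.ofReal (Real.sqrt 2) := by
  rw [gaussianReal_of_var_ne_zero 0 (by norm_num), lintegral_withDensity_eq_lintegral_mul _
    (measurable_gaussianPDF _ _) (by fun_prop)]
  have h : ∀ x : ℝ, (gaussianPDF 0 (1 / 2) * fun x => ENNReal.ofReal (Real.exp (x ^ 2 / 2))) x =
      ENNReal.ofReal ((Real.sqrt Real.pi)⁻¹ * Real.exp (-(1 / 2) * x ^ 2)) := by
    intro x
    rw [Pi.mul_apply, gaussianPDF, ← ENNReal.ofReal_mul (gaussianPDFReal_nonneg _ _ _),
      gaussianPDFReal, mul_assoc, ← Real.exp_add]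
    congr 3
    · congr 1
      push_cast
      ring
    · push_cast
      ring
  simp_rw [h]
  rw [← ofReal_integral_eq_lintegral_ofReal
    ((integrable_exp_neg_mul_sq (by norm_num)).const_mul _)
    (Filter.Eventually.of_forall fun x => by positivity), integral_const_mul, integral_gaussian]
  congr 1
  rw [← Real.sqrt_inv, ← Real.sqrt_mul (by positivity)]
  congr 1
  field_simp

theorem lintegral_exp_sq_stdComplexGaussian :
    ∫⁻ z, ENNReal.ofReal (Real.exp (‖z‖ ^ 2 / 2)) ∂stdComplexGaussian = 2 := by
  rw [stdComplexGaussian, lintegral_map (by fun_prop) (by fun_prop)]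
  have h : ∀ z : ℝ × ℝ, ENNReal.ofReal (Real.exp (‖(z.1 : ℂ) + (z.2 : ℂ) * Complex.I‖ ^ 2 / 2)) =
      ENNReal.ofReal (Real.exp (z.1 ^ 2 / 2)) * ENNReal.ofReal (Real.exp (z.2 ^ 2 / 2)) := by
    intro z
    rw [← ENNReal.ofReal_mul (Real.exp_pos _).le, ← Real.exp_add, ← Complex.normSq_eq_norm_sq,
      Complex.normSq_add_mul_I]
    congr 2
    ring
  simp_rw [h]
  rw [lintegral_prod_mul (f := fun x : ℝ => ENNReal.ofReal (Real.exp (x ^ 2 / 2)))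
    (g := fun x : ℝ => ENNReal.ofReal (Real.exp (x ^ 2 / 2))) (by fun_prop) (by fun_prop),
    lintegral_exp_sq_gaussianReal, ← ENNReal.ofReal_mul (Real.sqrt_nonneg _),
    Real.mul_self_sqrt (by norm_num)]
  simp

/-- Convexity of the exponential in `w`, between the means `1` at `w = 0` and `2` at `w = 1`, gives
`1 + w ≤ e^w`. -/
theorem lintegral_exp_mul_sq_le {w : ℝ} (hw0 : 0 ≤ w) (hw1 : w ≤ 1) :
    ∫⁻ z, ENNReal.ofReal (Real.exp (w * ‖z‖ ^ 2 / 2)) ∂stdComplexGaussian ≤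
      ENNReal.ofReal (Real.exp w) := by
  have hpt : ∀ z : ℂ, ENNReal.ofReal (Real.exp (w * ‖z‖ ^ 2 / 2)) ≤
      ENNReal.ofReal (1 - w) + ENNReal.ofReal w * ENNReal.ofReal (Real.exp (‖z‖ ^ 2 / 2)) := by
    intro z
    rw [← ENNReal.ofReal_mul hw0, ← ENNReal.ofReal_add (by linarith) (by positivity)]
    refine ENNReal.ofReal_le_ofReal ?_
    have := convexOn_exp.2 (Set.mem_univ 0) (Set.mem_univ (‖z‖ ^ 2 / 2))
      (sub_nonneg.2 hw1) hw0 (by ring)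
    simpa [mul_div_assoc] using this
  refine (lintegral_mono hpt).trans ?_
  rw [lintegral_add_left (by fun_prop), lintegral_const, measure_univ, mul_one,
    lintegral_const_mul _ (by fun_prop), lintegral_exp_sq_stdComplexGaussian,
    show (2 : ℝ≥0∞) = ENNReal.ofReal 2 by simp, ← ENNReal.ofReal_mul hw0,
    ← ENNReal.ofReal_add (by linarith) (by positivity)]
  refine ENNReal.ofReal_le_ofReal ?_
  linarith [Real.add_one_le_exp w]

/-- Chernoff bound for weighted sums of squares of independent Gaussian variables. -/
theorem gaussianSequence_weighted_sum_ge_le (s : Finset ℤ) {w : ℤ → ℝ} (hw0 : ∀ n, 0 ≤ w n)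
    (hw1 : ∀ n, w n ≤ 1) (x : ℝ) :
    gaussianSequence {g | x ≤ ∑ n ∈ s, w n * ‖g n‖ ^ 2} ≤
      ENNReal.ofReal (Real.exp (∑ n ∈ s, w n - x / 2)) := by
  have hm : ∀ n, Measurable fun z : ℂ => ENNReal.ofReal (Real.exp (w n * ‖z‖ ^ 2 / 2)) :=
    fun n => by fun_prop
  have hprod : ∫⁻ g, ∏ n ∈ s, ENNReal.ofReal (Real.exp (w n * ‖g n‖ ^ 2 / 2)) ∂gaussianSequence ≤
      ENNReal.ofReal (Real.exp (∑ n ∈ s, w n)) := by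
    have hind : iIndepFun (fun (n : ℤ) (g : ℤ → ℂ) =>
        ENNReal.ofReal (Real.exp (w n * ‖g n‖ ^ 2 / 2))) gaussianSequence :=
      iIndepFun_infinitePi (P := fun _ : ℤ => stdComplexGaussian)
        (X := fun n z => ENNReal.ofReal (Real.exp (w n * ‖z‖ ^ 2 / 2))) hm
    rw [lintegral_prod_eq_prod_lintegral_of_indepFun s _ hind
      (fun n => (hm n).comp (measurable_pi_apply n)), Real.exp_sum,
      ENNReal.ofReal_prod_of_nonneg fun n _ => (Real.exp_pos _).le]
    refine Finset.prod_le_prod' fun n _ => ?_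
    have hmp := measurePreserving_eval_infinitePi (fun _ : ℤ => stdComplexGaussian) n
    refine le_trans (le_of_eq ?_) (lintegral_exp_mul_sq_le (hw0 n) (hw1 n))
    exact hmp.lintegral_comp (hm n)
  have hmark := mul_meas_ge_le_lintegral (μ := gaussianSequence)
    (f := fun g : ℤ → ℂ => ∏ n ∈ s, ENNReal.ofReal (Real.exp (w n * ‖g n‖ ^ 2 / 2)))
    (Finset.measurable_prod _ fun n _ => (hm n).comp (measurable_pi_apply n))
    (ENNReal.ofReal (Real.exp (x / 2)))
  have hsub : {g : ℤ → ℂ | x ≤ ∑ n ∈ s, w n * ‖g n‖ ^ 2} ⊆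
      {g | ENNReal.ofReal (Real.exp (x / 2)) ≤
        ∏ n ∈ s, ENNReal.ofReal (Real.exp (w n * ‖g n‖ ^ 2 / 2))} := by
    intro g hg
    rw [Set.mem_ofPred_eq] at hg ⊢
    rw [← ENNReal.ofReal_prod_of_nonneg fun n _ => (Real.exp_pos _).le, ← Real.exp_sum,
      ← Finset.sum_div]
    exact ENNReal.ofReal_le_ofReal (Real.exp_le_exp.2 (by linarith))
  refine (measure_mono hsub).trans ?_
  have hpos : ENNReal.ofReal (Real.exp (x / 2)) ≠ 0 := by
    simpa using Real.exp_pos (x / 2)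
  rw [Real.exp_sub, ENNReal.ofReal_div_of_pos (Real.exp_pos _), ENNReal.le_div_iff_mul_le
    (Or.inl hpos) (Or.inl ENNReal.ofReal_ne_top), mul_comm]
  exact hmark.trans hprod

/-! ### From tails to moments -/

/-- A tail `C exp (-c t ^ z)` gives `L^p` norms of size `p ^ (1 / z)`. -/
theorem exists_eLpNorm_le_of_tail {C c z : ℝ} (hC : 0 < C) (hc : 0 < c) (hz : 0 < z) :
    ∃ C' : ℝ, 0 < C' ∧ ∀ {Ω : Type} [MeasurableSpace Ω] (μ : Measure Ω) (f : Ω → ℝ),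
      Measurable f →
      (∀ t : ℝ, 0 ≤ t → μ {x | t ≤ |f x|} ≤ ENNReal.ofReal (C * Real.exp (-c * t ^ z))) →
      ∀ p : ℝ, 1 ≤ p → eLpNorm f (ENNReal.ofReal p) μ ≤ ENNReal.ofReal (C' * p ^ (1 / z)) := by
  have hsum : Summable fun j : ℕ => C * Real.exp (1 / 2) * Real.exp (-(1 / 2)) ^ j :=
    (summable_geometric_of_lt_one (Real.exp_pos _).le
      (by rw [Real.exp_lt_one_iff]; norm_num)).mul_left _
  set M : ℝ := ∑' j : ℕ, C * Real.exp (1 / 2) * Real.exp (-(1 / 2)) ^ j with hM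
  have hM0 : 0 ≤ M := tsum_nonneg fun j => by positivity
  -- The constant depends on `C`, `c`, `z` alone, so it serves all `N` and both signs.
  refine ⟨(2 / (z * c)) ^ (1 / z) * max 1 M, by positivity, ?_⟩
  intro Ω _ μ f hf htail p hp
  have hp0 : 0 < p := by linarith
  set Y : Ω → ℝ := fun x => c * |f x| ^ z with hY
  have hY0 : ∀ x, 0 ≤ Y x := fun x => by positivity
  have hYm : Measurable Y := by
    have : Measurable fun x => |f x| := hf.abs
    exact (this.pow_const z).const_mul c
  have hYtail : ∀ y : ℝ, 0 ≤ y → μ {x | y ≤ Y x} ≤ ENNReal.ofReal (C * Real.exp (-y)) := by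
    intro y hy
    have h := htail ((y / c) ^ (1 / z)) (by positivity)
    rw [← Real.rpow_mul (by positivity), one_div_mul_cancel hz.ne', Real.rpow_one, neg_mul,
      mul_div_cancel₀ _ hc.ne'] at h
    refine (measure_mono fun x hx => ?_).trans h
    rw [Set.mem_ofPred_eq] at hx ⊢
    have h1 : y / c ≤ |f x| ^ z := by
      rw [div_le_iff₀ hc, mul_comm]
      exact hx
    have h2 := Real.rpow_le_rpow (by positivity) h1 (show 0 ≤ 1 / z by positivity)
    rwa [← Real.rpow_mul (abs_nonneg _), mul_one_div_cancel hz.ne', Real.rpow_one] at h2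
  -- Slicing by the integer part of `Y`, the slice `j` contributes at most `e^{(j+1)/2} · C e^{-j}`,
  -- a geometric series with sum `M`.
  have hexp : ∫⁻ x, ENNReal.ofReal (Real.exp (Y x / 2)) ∂μ ≤ ENNReal.ofReal M := by
    have hms : ∀ j : ℕ, MeasurableSet {x | (j : ℝ) ≤ Y x} := fun j =>
      measurableSet_le measurable_const hYm
    have hpt : ∀ x, ENNReal.ofReal (Real.exp (Y x / 2)) ≤
        ∑' j : ℕ, {x | (j : ℝ) ≤ Y x}.indicator
          (fun _ => ENNReal.ofReal (Real.exp (((j : ℝ) + 1) / 2))) x := by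
      intro x
      refine le_trans ?_ (ENNReal.le_tsum ⌊Y x⌋₊)
      rw [Set.indicator_of_mem (show x ∈ {y | ((⌊Y x⌋₊ : ℕ) : ℝ) ≤ Y y} from
        Nat.floor_le (hY0 x))]
      refine ENNReal.ofReal_le_ofReal (Real.exp_le_exp.2 ?_)
      have := (Nat.lt_floor_add_one (Y x)).le
      linarith
    refine (lintegral_mono hpt).trans ?_
    rw [lintegral_tsum fun j => (measurable_const.indicator (hms j)).aemeasurable, hM,
      ENNReal.ofReal_tsum_of_nonneg (fun j => by positivity) hsum]
    refine ENNReal.tsum_le_tsum fun j => ?_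
    rw [lintegral_indicator_const (hms j)]
    refine (mul_le_mul_right (hYtail j (Nat.cast_nonneg j)) _).trans ?_
    rw [← ENNReal.ofReal_mul (Real.exp_pos _).le]
    refine ENNReal.ofReal_le_ofReal (le_of_eq ?_)
    rw [← Real.exp_nat_mul, mul_left_comm, ← Real.exp_add, mul_assoc, ← Real.exp_add]
    congr 2
    ring
  set m := p / z with hm
  have hm0 : 0 < m := by positivity
  -- The inequality `y ≤ 2m e^{y/(2m)}` raised to the power `m = p/z` gives `y^m ≤ (2m)^m e^{y/2}`;
  -- the `p`-th root of `(2m/c)^m` is the source of `p^{1/z}`.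
  have hpow : ∀ x, ‖f x‖ₑ ^ p ≤
      ENNReal.ofReal ((2 * m / c) ^ m) * ENNReal.ofReal (Real.exp (Y x / 2)) := by
    intro x
    rw [Real.enorm_eq_ofReal_abs, ENNReal.ofReal_rpow_of_nonneg (abs_nonneg _) hp0.le,
      ← ENNReal.ofReal_mul (by positivity)]
    refine ENNReal.ofReal_le_ofReal ?_
    have e1 : |f x| ^ p = (Y x / c) ^ m := by
      rw [hY, mul_div_cancel_left₀ _ hc.ne', ← Real.rpow_mul (abs_nonneg _), hm,
        mul_div_cancel₀ _ hz.ne']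
    have e2 : Y x / c ≤ 2 * m / c * Real.exp (Y x / (2 * m)) := by
      rw [div_mul_eq_mul_div]
      refine div_le_div_of_nonneg_right ?_ hc.le
      have := Real.add_one_le_exp (Y x / (2 * m))
      have h2 : Y x = 2 * m * (Y x / (2 * m)) := by field_simp
      nlinarith
    rw [e1]
    refine (Real.rpow_le_rpow (by have := hY0 x; positivity) e2 hm0.le).trans (le_of_eq ?_)
    rw [Real.mul_rpow (by positivity) (Real.exp_pos _).le, ← Real.exp_mul]
    congr 2
    field_simp
  have hint : ∫⁻ x, ‖f x‖ₑ ^ p ∂μ ≤ ENNReal.ofReal ((2 * m / c) ^ m * M) := by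
    refine (lintegral_mono hpow).trans ?_
    rw [lintegral_const_mul _ (by fun_prop), ENNReal.ofReal_mul (by positivity)]
    exact mul_le_mul_right hexp _
  rw [eLpNorm_eq_lintegral_rpow_enorm_toReal (by simpa using hp0) ENNReal.ofReal_ne_top,
    ENNReal.toReal_ofReal hp0.le]
  refine (ENNReal.rpow_le_rpow hint (by positivity)).trans ?_
  rw [ENNReal.ofReal_rpow_of_nonneg (by positivity) (by positivity)]
  refine ENNReal.ofReal_le_ofReal ?_
  rw [Real.mul_rpow (by positivity) hM0, ← Real.rpow_mul (by positivity)]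
  have e1 : m * (1 / p) = 1 / z := by
    rw [hm]
    field_simp
  have e2 : 2 * m / c = 2 / (z * c) * p := by
    rw [hm]
    field_simp
  -- Since `p ≥ 1`, this bound is uniform in `p`.
  have e3 : M ^ (1 / p) ≤ max 1 M := by
    have h1 : M ^ (1 / p) ≤ max 1 M ^ (1 / p) :=
      Real.rpow_le_rpow hM0 (le_max_right _ _) (by positivity)
    refine h1.trans ?_
    have := Real.rpow_le_rpow_of_exponent_le (le_max_left 1 M)
      (show 1 / p ≤ 1 by rw [div_le_one hp0]; exact hp)
    rwa [Real.rpow_one] at this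
  rw [e1, e2, Real.mul_rpow (by positivity) hp0.le, mul_right_comm]
  exact mul_le_mul_of_nonneg_right (mul_le_mul_of_nonneg_left e3 (by positivity)) (by positivity)

/-! ### The tail of the energy derivative -/

theorem proj_eq_of_hasSum {α : ℝ} {g : ℤ → ℂ} {u : L2T}
    (h : HasSum (fun n : ℤ => (g n / (Real.sqrt (1 + disp α n) : ℂ)) •
      fourierLp (T := 2 * Real.pi) 2 n) u) (N : ℕ) (n : Modes N) :
    proj N u n = g n / (Real.sqrt (weight α n) : ℂ) := by
  have h1 : HasSum (fun k : ℤ => (g k / (Real.sqrt (1 + disp α k) : ℂ)) •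
      fourierBasis (T := 2 * Real.pi) k) u := by
    rwa [coe_fourierBasis]
  have h2 := (h1.mapL (innerSL ℂ (fourierBasis (T := 2 * Real.pi) (n : ℤ))))
  have h3 : HasSum (fun k : ℤ => innerSL ℂ (fourierBasis (T := 2 * Real.pi) (n : ℤ))
      ((g k / (Real.sqrt (1 + disp α k) : ℂ)) • fourierBasis (T := 2 * Real.pi) k))
      (g n / (Real.sqrt (weight α n) : ℂ)) := by
    have := hasSum_single (f := fun k : ℤ => innerSL ℂ (fourierBasis (T := 2 * Real.pi) (n : ℤ))
      ((g k / (Real.sqrt (1 + disp α k) : ℂ)) • fourierBasis (T := 2 * Real.pi) k)) (n : ℤ) ?_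
    · convert this using 1
      rw [innerSL_apply_apply, inner_smul_right, orthonormal_iff_ite.1 fourierBasis.orthonormal]
      simp [weight]
    · intro k hk
      rw [innerSL_apply_apply, inner_smul_right, orthonormal_iff_ite.1 fourierBasis.orthonormal,
        if_neg hk.symm, mul_zero]
  rw [← h2.unique h3, proj, ← fourierBasis_repr, HilbertBasis.repr_apply_apply, innerSL_apply_apply]

theorem sum_norm_sq_proj_le (N : ℕ) (u : L2T) : ∑ n, ‖proj N u n‖ ^ 2 ≤ ‖u‖ ^ 2 := by
  have h := (fourierBasis (T := 2 * Real.pi)).orthonormal.sum_inner_products_le u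
    (s := Finset.Icc (-(N : ℤ)) N)
  refine le_trans (le_of_eq ?_) h
  rw [← Finset.sum_coe_sort (Finset.Icc (-(N : ℤ)) N)
    fun n => ‖inner ℂ (fourierBasis (T := 2 * Real.pi) n) u‖ ^ 2]
  refine Finset.sum_congr rfl fun n _ => ?_
  rw [proj, ← fourierBasis_repr, HilbertBasis.repr_apply_apply]

/-- This identifies the deterministic hypothesis on the cut-off sum with the complement of the
Chernoff event. -/
theorem weight_mul_norm_sq_proj {α : ℝ} {g : ℤ → ℂ} {u : L2T}
    (h : HasSum (fun n : ℤ => (g n / (Real.sqrt (1 + disp α n) : ℂ)) •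
      fourierLp (T := 2 * Real.pi) 2 n) u) (N : ℕ) (n : Modes N) :
    weight α n * ‖proj N u n‖ ^ 2 = ‖g n‖ ^ 2 := by
  have hw := weight_pos α n
  rw [proj_eq_of_hasSum h, norm_div, div_pow, Complex.norm_real,
    Real.norm_of_nonneg (Real.sqrt_nonneg _), Real.sq_sqrt hw.le, mul_div_cancel₀ _ hw.ne']

theorem gammaTilde_le_one {α : ℝ} (h0 : 9 / 10 < α) (R : ℝ) (s : Set L2T) :
    gammaTilde α R s ≤ 1 := by
  have := isProbabilityMeasure_gammaMeasure (α := α) (by linarith)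
  exact (Measure.restrict_apply_le _ _).trans prob_le_one

/-- The constant in the deterministic bound for the energy derivative. -/
def boundConst (α R : ℝ) : ℝ :=
  Real.pi * (weightSum α * (R ^ 2 + (2 * weightSum α + 2)) ^ 2 +
    4 * (3 * sumInvSq * weightSum α * (R ^ 2 + (2 * weightSum α + 2)) ^ 3)) + 1

theorem boundConst_pos (α R : ℝ) : 0 < boundConst α R := by
  have hS := weightSum_nonneg α
  have hZ := sumInvSq_nonneg
  unfold boundConst
  positivity

/-- By contraposition: if the cut-off Gaussian sum stays below `(2S+2)λ` and `‖u‖ ≤ R`, the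
deterministic bound forces `|G_N| < t`. Up to a null set, the event lies in the Chernoff event. -/
theorem gammaTilde_energyDerivative_le {σ α R lam : ℝ} (hσ : |σ| = 1) (h0 : 9 / 10 < α)
    (h1 : α ≤ 1) (hl : 1 ≤ lam) (N : ℕ) {t : ℝ}
    (ht : boundConst α R * lam ^ (1 / zeta α) ≤ t) :
    gammaTilde α R {u | t ≤ |energyDerivative σ α N u|} ≤ ENNReal.ofReal (Real.exp (-lam)) := by
  have hS := weightSum_nonneg α
  have hA : MeasurableSet {u : L2T | t ≤ |energyDerivative σ α N u|} :=
    measurableSet_le measurable_const (continuous_energyDerivative σ α N).measurable.abs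
  have hB : MeasurableSet {u : L2T | ‖u‖ ≤ R} := measurableSet_le measurable_norm measurable_const
  rw [gammaTilde, Measure.restrict_apply hA, gammaMeasure,
    Measure.map_apply_of_aemeasurable (aemeasurable_randomSeries (by linarith)) (hA.inter hB)]
  -- The level `(2S+2)λ`, with `S = weightSum α`, makes the Chernoff exponent at most `Sλ - (S+1)λ =
  -- -λ`.
  have hch := gaussianSequence_weighted_sum_ge_le (Finset.Icc (-(N : ℤ)) N)
    (cutoff_nonneg (α := α) hl) (fun n => min_le_left _ _) ((2 * weightSum α + 2) * lam)
  have hexp : ∑ n ∈ Finset.Icc (-(N : ℤ)) N, cutoff α lam n - (2 * weightSum α + 2) * lam / 2 ≤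
      -lam := by
    have := sum_cutoff_le h0 hl (Finset.Icc (-(N : ℤ)) N)
    linarith
  refine le_trans (measure_mono_ae ?_) (hch.trans
    (ENNReal.ofReal_le_ofReal (Real.exp_le_exp.2 hexp)))
  filter_upwards [ae_hasSum_randomSeries (α := α) (by linarith)] with g hg hgA
  obtain ⟨hgt, hgR⟩ : t ≤ |energyDerivative σ α N (randomSeries α g)| ∧ ‖randomSeries α g‖ ≤ R :=
    hgA
  change (2 * weightSum α + 2) * lam ≤ ∑ n ∈ Finset.Icc (-(N : ℤ)) N, cutoff α lam n * ‖g n‖ ^ 2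
  by_contra! hcon
  have hK : ∑ n : Modes N, cutoff α lam n * (weight α n * ‖proj N (randomSeries α g) n‖ ^ 2) ≤
      (2 * weightSum α + 2) * lam := by
    simp only [weight_mul_norm_sq_proj hg]
    rw [Finset.sum_coe_sort (Finset.Icc (-(N : ℤ)) N) fun n => cutoff α lam n * ‖g n‖ ^ 2]
    exact hcon.le
  have hR : ∑ n, ‖proj N (randomSeries α g) n‖ ^ 2 ≤ R ^ 2 :=
    (sum_norm_sq_proj_le N _).trans (pow_le_pow_left₀ (norm_nonneg _) hgR 2)
  have hb := abs_energyPolyDeriv_le_rpow hσ h0 h1 hl (by linarith) hR hK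
  rw [← energyDerivative_eq] at hb
  -- The summand `1` in `boundConst` makes the bound strictly smaller than `t`, which gives the
  -- contradiction.
  have hp : 0 < lam ^ (1 / zeta α) := Real.rpow_pos_of_pos (by linarith) _
  unfold boundConst at ht
  linarith

theorem gammaTilde_energyDerivative_tail {σ α R : ℝ} (hσ : |σ| = 1) (h0 : 9 / 10 < α)
    (h1 : α ≤ 1) (hz : 0 < zeta α) (N : ℕ) {t : ℝ} (ht : 0 ≤ t) :
    gammaTilde α R {u | t ≤ |energyDerivative σ α N u|} ≤
      ENNReal.ofReal (Real.exp 1 * Real.exp (-(boundConst α R)⁻¹ ^ zeta α * t ^ zeta α)) := by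
  have hC := boundConst_pos α R
  set B := boundConst α R
  have e : -B⁻¹ ^ zeta α * t ^ zeta α = -(t / B) ^ zeta α := by
    rw [div_eq_inv_mul, Real.mul_rpow (by positivity) ht]
    ring
  rw [e, ← Real.exp_add]
  -- This `λ` solves `B λ^{1/ζ} = t`. For `λ ≤ 1` the trivial bound by `1` is covered by the
  -- prefactor `e`.
  set lam := (t / B) ^ zeta α with hlam
  rcases le_total lam 1 with hl | hl
  · refine (gammaTilde_le_one h0 R _).trans ?_
    rw [ENNReal.one_le_ofReal]
    exact Real.one_le_exp (by linarith)
  · refine (gammaTilde_energyDerivative_le hσ h0 h1 hl N (le_of_eq ?_)).trans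
      (ENNReal.ofReal_le_ofReal (Real.exp_le_exp.2 (by linarith)))
    rw [hlam, ← Real.rpow_mul (by positivity), mul_one_div_cancel hz.ne', Real.rpow_one]
    exact mul_div_cancel₀ _ hC.ne'

end BirkhoffNLS

end

/-! ### The proposition -/

theorem proposition5p1 (α : ℝ) (hα : (1 + Real.sqrt 97) / 12 < α) (hα1 : α ≤ 1) :
    1 < BirkhoffNLS.zeta α ∧
    ∀ R : ℝ, 0 < R → ∃ C : ℝ, 0 < C ∧ ∃ c : ℝ, 0 < c ∧
      ∀ σ : ℝ, (σ = 1 ∨ σ = -1) → ∀ N : ℕ,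
        (∀ u : BirkhoffNLS.L2T,
          DifferentiableAt ℝ (BirkhoffNLS.energyAlongFlow σ α N u) 0) ∧
        (∀ p : ℝ, 1 ≤ p →
          MeasureTheory.MemLp (BirkhoffNLS.energyDerivative σ α N) (ENNReal.ofReal p)
            (BirkhoffNLS.gammaTilde α R) ∧
          MeasureTheory.eLpNorm (BirkhoffNLS.energyDerivative σ α N) (ENNReal.ofReal p)
            (BirkhoffNLS.gammaTilde α R) ≤
              ENNReal.ofReal (C * p ^ (1 / BirkhoffNLS.zeta α))) ∧
        (∀ t : ℝ, 0 ≤ t →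
          BirkhoffNLS.gammaTilde α R {u | t ≤ |BirkhoffNLS.energyDerivative σ α N u|} ≤
            ENNReal.ofReal (C * Real.exp (-c * t ^ BirkhoffNLS.zeta α))) := by
  have h0 := BirkhoffNLS.nine_tenths_lt hα
  have hz1 := BirkhoffNLS.one_lt_zeta hα hα1
  have hz : 0 < BirkhoffNLS.zeta α := by linarith
  refine ⟨hz1, fun R _ => ?_⟩
  have hB := BirkhoffNLS.boundConst_pos α R
  have hc : 0 < (BirkhoffNLS.boundConst α R)⁻¹ ^ BirkhoffNLS.zeta α :=
    Real.rpow_pos_of_pos (inv_pos.2 hB) _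
  obtain ⟨C', hC', hLp⟩ := BirkhoffNLS.exists_eLpNorm_le_of_tail (Real.exp_pos 1) hc hz
  -- A single `C` serves for both the tail, with prefactor `e`, and the moments, with constant `C'`.
  refine ⟨max (Real.exp 1) C', lt_max_of_lt_right hC', _, hc, fun σ hσ N => ?_⟩
  have hσ1 : |σ| = 1 := by
    rcases hσ with rfl | rfl <;> simp
  have htail : ∀ t : ℝ, 0 ≤ t →
      BirkhoffNLS.gammaTilde α R {u | t ≤ |BirkhoffNLS.energyDerivative σ α N u|} ≤ _ :=
    fun t ht => BirkhoffNLS.gammaTilde_energyDerivative_tail hσ1 h0 hα1 hz N ht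
  have hmeas := (BirkhoffNLS.continuous_energyDerivative σ α N).measurable
  refine ⟨fun u => (BirkhoffNLS.hasDerivAt_energyAlongFlow σ α N u).differentiableAt,
    fun p hp => ?_, fun t ht => (htail t ht).trans (ENNReal.ofReal_le_ofReal
      (mul_le_mul_of_nonneg_right (le_max_left _ _) (Real.exp_pos _).le))⟩
  have hle := (hLp (BirkhoffNLS.gammaTilde α R) _ hmeas htail p hp).trans
    (ENNReal.ofReal_le_ofReal (mul_le_mul_of_nonneg_right (le_max_right (Real.exp 1) C')
      (Real.rpow_nonneg (by linarith) _)))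
  exact ⟨⟨hmeas.aestronglyMeasurable, hle.trans_lt ENNReal.ofReal_lt_top⟩, hle⟩
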